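/- Notation. For a Hermitian matrix $A=(a_{ij})$ of size $n$ put $\rho'(A)=\frac1{n^2}\sum_{i,j}a_{ij}$ and $$\mathrm{disc}(A)=\max_{\varnothing\ne X,Y\subset[n]}\frac{1}{\sqrt{|X||Y|}}\Big|\sum_{i\in X}\sum_{j\in Y}(a_{ij}-\rho'(A))\Big|.$$ For a graph $G$ of order $n\ge 2$ put $\rho(G)=e(G)/\binom n2$, let $e(X,Y)$ be the number of ordered pairs $(u,v)$ of adjacent vertices with $u\in X$, $v\in Y$, and put $$\mathrm{disc}_2(G)=\max_{\varnothing\ne X,Y\subset V(G)}\frac{1}{\sqrt{|X||Y|}}\big|e(X,Y)-\rho(G)|X||Y|\big|.$$ $\mu_2(G)$ and $\sigma_2(G)$ denote the second largest eigenvalue and the second largest singular value of the adjacency matrix of $G$ (counted with multiplicity). Construction. Let $p$ be a prime and $k=\lceil p^{1/5}\rceil$. For $t\in[p]$ let $Q(p,t)$ be the graph on $[p]$ in which distinct $u,v$ are adjacent if and only if the fractional part of $(u-v)^2/p$ is at most $t/p$; this graph is regular. Let $\mathcal V_p$ be the set of the degrees of the graphs $Q(p,t)$, $t\in[p]$, and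 for $d\in\mathcal V_p$ let $A(p,d)$ be the adjacency matrix of a $d$-regular graph $Q(p,t)$, $t\in[p]$. Let $D=(d_{ij})_{i,j=1}^k$ be a symmetric matrix such that $d_{ij}$ is an element of $\mathcal V_p$ at minimal distance from $\frac p2+\frac p{2\sqrt{ij}}$. Let $\mathcal A'$ be the $kp\times kp$ block matrix whose $(i,j)$ block is $A(p,d_{ij})$ and, with $E$ the all-ones matrix of size $kp$, let $$\mathcal A=\begin{pmatrix}\mathcal A'&E-\mathcal A'\\E-\mathcal A'&\mathcal A'\end{pmatrix}.$$ Theorem. (1) For every sufficiently large prime $p$, every such matrix $\mathcal A$ satisfies $\mathrm{disc}(\mathcal A)\le 12p$. (2) There is an absolute constant $C>0$ such that for every sufficiently large prime $p$ such matrices $\mathcal A$ exist, and every such $\mathcal A$ is the adjacency matrix of a $kp$-regular graph $G$ of order $2kp$ with $$\mu_2(G)\ge C\,\mathrm{disc}_2(G)\log|G|.$$ In particular there are infinitely many dense regular graphs with this property. (3) Consequently, there is no absolute constant $C$ such that $\sigma_2(G)<C\,\mathrm{disc}_2(G)$ for every regular graph $G$ with at least one edge. -/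

import Mathlib

namespace HermitianDisc

/-- The average entry of a square matrix. -/
noncomputable def avgEntry {V 𝕜 : Type*} [Fintype V] [RCLike 𝕜] (A : Matrix V V 𝕜) : 𝕜 :=
  (1 / (Fintype.card V : 𝕜) ^ 2) * ∑ i, ∑ j, A i j

/-- The discrepancy of a (Hermitian) matrix: a maximum over all pairs of nonempty index sets. -/
noncomputable def disc {V 𝕜 : Type*} [Fintype V] [RCLike 𝕜] (A : Matrix V V 𝕜) : ℝ :=
  ⨆ P : {X : Finset V // X.Nonempty} × {Y : Finset V // Y.Nonempty},
    1 / √((P.1.1.card : ℝ) * (P.2.1.card : ℝ)) *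
      ‖∑ i ∈ P.1.1, ∑ j ∈ P.2.1, (A i j - avgEntry A)‖

/-- The edge density of a graph. -/
noncomputable def density {V : Type*} [Fintype V] [DecidableEq V] (G : SimpleGraph V)
    [DecidableRel G.Adj] : ℝ :=
  (G.edgeFinset.card : ℝ) / ((Fintype.card V).choose 2 : ℝ)

/-- The discrepancy of a graph; `G.interedges X Y` consists of the ordered pairs `(u, v)` of
adjacent vertices with `u ∈ X` and `v ∈ Y`. -/
noncomputable def disc₂ {V : Type*} [Fintype V] [DecidableEq V] (G : SimpleGraph V)
    [DecidableRel G.Adj] : ℝ :=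
  ⨆ P : {X : Finset V // X.Nonempty} × {Y : Finset V // Y.Nonempty},
    1 / √((P.1.1.card : ℝ) * (P.2.1.card : ℝ)) *
      |((G.interedges P.1.1 P.2.1).card : ℝ)
        - density G * (P.1.1.card : ℝ) * (P.2.1.card : ℝ)|

/-- The second largest eigenvalue (with multiplicity) of the adjacency matrix of a graph with at
least two vertices. -/
noncomputable def μ₂ {V : Type*} [Fintype V] [DecidableEq V] (G : SimpleGraph V)
    [DecidableRel G.Adj] : ℝ :=
  if h : 1 < Fintype.card V then (G.isHermitian_adjMatrix ℝ).eigenvalues₀ ⟨1, h⟩ else 0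

/-- The second largest singular value (with multiplicity) of the adjacency matrix of a graph. -/
noncomputable def σ₂ {V : Type*} [Fintype V] [DecidableEq V] (G : SimpleGraph V)
    [DecidableRel G.Adj] : ℝ :=
  (Matrix.toEuclideanLin (G.adjMatrix ℝ)).singularValues 1

/-- The graph on `p` vertices, in which distinct `u`, `v` are joined when the fractional part of
`(u - v)² / p` is at most `t / p`. -/
def Q (p t : ℕ) : SimpleGraph (Fin p) where
  Adj u v := u ≠ v ∧
    Int.fract ((((u : ℕ) : ℚ) - ((v : ℕ) : ℚ)) ^ 2 / (p : ℚ)) ≤ (t : ℚ) / (p : ℚ)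
  symm := ⟨fun u v h => ⟨h.1.symm, by rw [← neg_sub, neg_sq]; exact h.2⟩⟩
  loopless := ⟨fun _ h => h.1 rfl⟩

instance (p t : ℕ) : DecidableRel (Q p t).Adj := fun u v =>
  inferInstanceAs (Decidable (u ≠ v ∧
    Int.fract ((((u : ℕ) : ℚ) - ((v : ℕ) : ℚ)) ^ 2 / (p : ℚ)) ≤ (t : ℚ) / (p : ℚ)))

/-- The set of the degrees of the (regular) graphs `Q p t`, `1 ≤ t ≤ p`. -/
def degreeSet (p : ℕ) : Set ℕ :=
  {d | ∃ t ∈ Finset.Icc 1 p, (Q p t).IsRegularOfDegree d}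

/-- `A d` is, for every `d ∈ degreeSet p`, the adjacency matrix of a graph `Q p t`, `1 ≤ t ≤ p`,
that is regular of degree `d`. -/
def IsBlockFamily (p : ℕ) (A : ℕ → Matrix (Fin p) (Fin p) ℝ) : Prop :=
  ∀ d ∈ degreeSet p, ∃ t ∈ Finset.Icc 1 p,
    (Q p t).IsRegularOfDegree d ∧ A d = (Q p t).adjMatrix ℝ

/-- `D` is a symmetric matrix of elements of `degreeSet p`, and the entry in row `i` and column `j`
(counted from 1) is as close as possible to `p / 2 + p / (2 √(i j))`. -/
def IsDegreeMatrix (p k : ℕ) (D : Matrix (Fin k) (Fin k) ℕ) : Prop :=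
  D.IsSymm ∧ ∀ i j : Fin k, D i j ∈ degreeSet p ∧ ∀ x ∈ degreeSet p,
    |(D i j : ℝ) - ((p : ℝ) / 2 + (p : ℝ) / (2 * √(((i : ℝ) + 1) * ((j : ℝ) + 1))))| ≤
      |(x : ℝ) - ((p : ℝ) / 2 + (p : ℝ) / (2 * √(((i : ℝ) + 1) * ((j : ℝ) + 1))))|

/-- The number `⌈p ^ (1 / 5)⌉`. -/
noncomputable def blockCount (p : ℕ) : ℕ := ⌈(p : ℝ) ^ (1 / 5 : ℝ)⌉₊

/-- The `kp × kp` block matrix whose block with index `(i, j)` is `A (D i j)`. -/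
def blockMatrix {p k : ℕ} (D : Matrix (Fin k) (Fin k) ℕ)
    (A : ℕ → Matrix (Fin p) (Fin p) ℝ) : Matrix (Fin k × Fin p) (Fin k × Fin p) ℝ :=
  Matrix.of fun x y => A (D x.1 y.1) x.2 y.2

/-- The index set of the `2kp` rows, where `k = blockCount p`. -/
abbrev Idx (p : ℕ) : Type := (Fin (blockCount p) × Fin p) ⊕ (Fin (blockCount p) × Fin p)

/-- `M` is the `2kp × 2kp` matrix with the blocks `B`, `E - B`, `E - B`, `B`, where `E` is the
all-ones matrix and `B` is a block matrix as above with `k = blockCount p`. -/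
def IsConstructed (p : ℕ) (M : Matrix (Idx p) (Idx p) ℝ) : Prop :=
  ∃ (D : Matrix (Fin (blockCount p)) (Fin (blockCount p)) ℕ)
    (A : ℕ → Matrix (Fin p) (Fin p) ℝ),
    IsDegreeMatrix p (blockCount p) D ∧ IsBlockFamily p A ∧
    M = Matrix.fromBlocks (blockMatrix D A) (Matrix.of (fun _ _ => 1) - blockMatrix D A)
      (Matrix.of (fun _ _ => 1) - blockMatrix D A) (blockMatrix D A)

end HermitianDisc

/-! The graphs `Q p t` are quasirandom. Expanding the indicator of an initial interval of residues
into additive characters, each nonzero frequency `h` contributes the matrix of the characters of `h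
(u - v)²`, which is `√p` times a unitary matrix. The normalised Fourier coefficients have ℓ¹ norm
`O(log p)`, so an adjacency matrix differs from its mean by an operator of norm `O(√p log p)`
(`abs_sum_adjMatrix_Q_sub_le`).

The degrees of `Q p t` grow in steps of at most 2, so every target in `D` is met up to 2. As `k` is
about `p ^ (1/5)`, the block matrix minus `1/2` is, up to norm `o(p)`, the rank-one form `w wᵀ / 2`,
where `w` is `1/√i` on block `i` (`abs_sum_blockMatrix_sub_le`). Doubling makes the graph regular
and puts `(w, -w)` orthogonal to the constants; as `‖w‖²` is `p` times a harmonic number, the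
Rayleigh quotient there is about `p log k`.

Vectors with entries in `{-1, 0, 1}` cannot exploit this: `w` is spread evenly over about `log k`
dyadic scales, and a set of given size profits from essentially one. Hence `|⟨w, x⟩| ≤ 3 √(p |X|)`
(`abs_sum_div_sqrt_le`) and the discrepancy is `O(p)`. The gap is the logarithm. -/

open scoped InnerProductSpace

/-! ### Lower bounds for a second eigenvalue. -/

/-- If an eigenvector `u` for an eigenvalue `κ ≥ c` is orthogonal to a vector `v` whose Rayleigh
quotient is at least `c`, then the second largest eigenvalue is at least `c`. -/
theorem LinearMap.IsSymmetric.le_second_eigenvalue {E : Type*} [NormedAddCommGroup E]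
    [InnerProductSpace ℝ E] [FiniteDimensional ℝ E] {T : E →ₗ[ℝ] E} (hT : T.IsSymmetric) {n : ℕ}
    (hn : Module.finrank ℝ E = n) (h1 : 1 < n) {u v : E} {κ c : ℝ} (hu : u ≠ 0) (hv : v ≠ 0)
    (huv : ⟪u, v⟫_ℝ = 0) (hTu : T u = κ • u) (hc : c ≤ κ) (hTv : c * ‖v‖ ^ 2 ≤ ⟪T v, v⟫_ℝ) :
    c ≤ hT.eigenvalues hn ⟨1, h1⟩ := by
  set b := hT.eigenvectorBasis hn
  set i₀ : Fin n := ⟨0, by omega⟩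
  -- Courant–Fischer: the plane spanned by `u` and `v` contains a nonzero vector orthogonal to the
  -- top eigenvector.
  obtain ⟨α, β, hne, horth⟩ : ∃ α β : ℝ, (α ≠ 0 ∨ β ≠ 0) ∧
      α * ⟪b i₀, u⟫_ℝ + β * ⟪b i₀, v⟫_ℝ = 0 := by
    by_cases h : ⟪b i₀, u⟫_ℝ = 0
    · exact ⟨1, 0, by simp, by simp [h]⟩
    · exact ⟨⟪b i₀, v⟫_ℝ, -⟪b i₀, u⟫_ℝ, by simp [h], by ring⟩
  set x := α • u + β • v
  have hvu : ⟪v, u⟫_ℝ = 0 := by rw [real_inner_comm]; exact huv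
  have hTvu : ⟪T v, u⟫_ℝ = 0 := by rw [hT v u, hTu, inner_smul_right, hvu, mul_zero]
  have hxx : ‖x‖ ^ 2 = α ^ 2 * ‖u‖ ^ 2 + β ^ 2 * ‖v‖ ^ 2 := by
    rw [← real_inner_self_eq_norm_sq, ← real_inner_self_eq_norm_sq, ← real_inner_self_eq_norm_sq]
    simp only [x, inner_add_left, inner_add_right, inner_smul_left, inner_smul_right, huv, hvu]
    simp; ring
  have hxpos : 0 < ‖x‖ ^ 2 := by
    rw [hxx]
    have hu' : 0 < ‖u‖ ^ 2 := by positivity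
    have hv' : 0 < ‖v‖ ^ 2 := by positivity
    rcases hne with h | h
    · have := mul_pos (sq_pos_of_ne_zero h) hu'; positivity
    · have := mul_pos (sq_pos_of_ne_zero h) hv'; positivity
  have hTx : c * ‖x‖ ^ 2 ≤ ⟪T x, x⟫_ℝ := by
    have : ⟪T x, x⟫_ℝ = κ * (α ^ 2 * ‖u‖ ^ 2) + β ^ 2 * ⟪T v, v⟫_ℝ := by
      rw [← real_inner_self_eq_norm_sq]
      simp only [x, map_add, map_smul, hTu, inner_add_left, inner_add_right, inner_smul_left,
        inner_smul_right, huv, hTvu]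
      simp; ring
    rw [this, hxx]
    nlinarith [mul_le_mul_of_nonneg_right hc (by positivity : 0 ≤ α ^ 2 * ‖u‖ ^ 2),
      mul_le_mul_of_nonneg_left hTv (sq_nonneg β)]
  have hx0 : ⟪b i₀, x⟫_ℝ = 0 := by
    simp only [x, inner_add_right, inner_smul_right]; exact horth
  have key : ⟪T x, x⟫_ℝ ≤ hT.eigenvalues hn ⟨1, h1⟩ * ‖x‖ ^ 2 := by
    rw [← b.sum_inner_mul_inner (T x) x, ← real_inner_self_eq_norm_sq,
      ← b.sum_inner_mul_inner x x, Finset.mul_sum]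
    refine Finset.sum_le_sum fun i _ => ?_
    have e1 : ⟪T x, b i⟫_ℝ = hT.eigenvalues hn i * ⟪x, b i⟫_ℝ := by
      rw [hT x (b i), hT.apply_eigenvectorBasis, inner_smul_right]; rfl
    rw [e1, real_inner_comm (b i) x, mul_assoc]
    by_cases hi : i = i₀
    · rw [hi, hx0]; simp
    · refine mul_le_mul_of_nonneg_right (hT.eigenvalues_antitone hn ?_) (mul_self_nonneg _)
      have : (i : ℕ) ≠ 0 := fun h => hi (Fin.ext h)
      exact Fin.mk_le_of_le_val (by omega)
  exact le_of_mul_le_mul_right (hTx.trans key) hxpos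

/-! ### Exponential sums modulo `p`. -/

theorem ZMod.norm_sub_one_stdAddChar {p : ℕ} [NeZero p] (h : ZMod p) :
    ‖ZMod.stdAddChar h - 1‖ = 2 * |Real.sin (Real.pi * h.val / p)| := by
  have : (ZMod.stdAddChar h : ℂ) = Complex.exp (Complex.I * (2 * Real.pi * h.val / p : ℝ)) := by
    conv_lhs => rw [show h = ((h.val : ℤ) : ZMod p) by simp]
    rw [ZMod.stdAddChar_coe]
    congr 1; push_cast; ring
  rw [this, Complex.norm_exp_I_mul_ofReal_sub_one, norm_mul, Real.norm_eq_abs, Real.norm_eq_abs]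
  simp only [abs_two]
  congr 3; ring

/-- Jordan's inequality on the half of the interval containing `x`. The sum of both terms replaces
their maximum because it adds up to two harmonic sums. -/
theorem inv_sin_le_inv_add_inv {x : ℝ} (h0 : 0 < x) (h1 : x < 1) :
    1 / |Real.sin (Real.pi * x)| ≤ 1 / (2 * x) + 1 / (2 * (1 - x)) := by
  have hpi := Real.pi_pos
  have aux : ∀ y : ℝ, 0 < y → y ≤ 1 / 2 → 1 / |Real.sin (Real.pi * y)| ≤ 1 / (2 * y) := by
    intro y hy hy'
    have := Real.mul_le_sin (x := Real.pi * y) (by positivity) (by nlinarith)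
    have h2 : 2 / Real.pi * (Real.pi * y) = 2 * y := by field_simp
    rw [h2] at this
    exact one_div_le_one_div_of_le (by positivity) (this.trans (le_abs_self _))
  rcases le_total x (1 / 2) with h | h
  · have : 0 ≤ 1 / (2 * (1 - x)) := by have := sub_pos.2 h1; positivity
    linarith [aux x h0 h]
  · have e : Real.sin (Real.pi * x) = Real.sin (Real.pi * (1 - x)) := by
      rw [mul_sub, mul_one, Real.sin_pi_sub]
    have : 0 ≤ 1 / (2 * x) := by positivity
    rw [e]
    linarith [aux (1 - x) (by linarith) (by linarith)]

/-- A geometric series of unimodular terms is at most `2 / ‖ψ(-h) - 1‖`, whatever its length. -/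
theorem ZMod.norm_sum_range_stdAddChar_le {p : ℕ} [Fact p.Prime] (t : ℕ) {h : ZMod p}
    (hh : h ≠ 0) : ‖∑ j ∈ Finset.range t, ZMod.stdAddChar (-(h * (j : ZMod p)))‖ ≤
      p / 2 * ((h.val : ℝ)⁻¹ + ((p - h.val : ℕ) : ℝ)⁻¹) := by
  have hp : 0 < (p : ℝ) := by exact_mod_cast (Fact.out : p.Prime).pos
  have hv0 : 0 < (h.val : ℝ) := by
    exact_mod_cast Nat.pos_of_ne_zero (by simpa using hh)
  have hvp : h.val < p := ZMod.val_lt h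
  have hvp' : (h.val : ℝ) < p := by exact_mod_cast hvp
  have hgeom : (∑ j ∈ Finset.range t, ZMod.stdAddChar (-(h * (j : ZMod p))) : ℂ)
      * (ZMod.stdAddChar (-h) - 1) = ZMod.stdAddChar (-h) ^ t - 1 := by
    rw [← geom_sum_mul]
    congr 1
    refine Finset.sum_congr rfl fun j _ => ?_
    rw [← AddChar.map_nsmul_eq_pow]
    congr 1; simp; ring
  have hone : ∀ z : ZMod p, ‖(ZMod.stdAddChar z : ℂ)‖ = 1 := fun z => by
    rw [ZMod.stdAddChar_apply]; exact Circle.norm_coe _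
  have hd : ‖(ZMod.stdAddChar (-h) : ℂ) - 1‖ = 2 * |Real.sin (Real.pi * (h.val / p))| := by
    have : ‖(ZMod.stdAddChar (-h) : ℂ) - 1‖ = ‖(ZMod.stdAddChar h : ℂ) - 1‖ := by
      have e : (ZMod.stdAddChar (-h) : ℂ) - 1 =
          -(ZMod.stdAddChar (-h)) * (ZMod.stdAddChar h - 1) := by
        have : (ZMod.stdAddChar (-h) : ℂ) * ZMod.stdAddChar h = 1 := by
          rw [← AddChar.map_add_eq_mul]; simp
        linear_combination this
      rw [e, norm_mul, norm_neg, hone, one_mul]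
    rw [this, ZMod.norm_sub_one_stdAddChar, mul_div_assoc]
  have hsin : 0 < |Real.sin (Real.pi * (h.val / p))| := by
    refine abs_pos.2 (Real.sin_pos_of_pos_of_lt_pi (by positivity) ?_).ne'
    have : (h.val : ℝ) / p < 1 := (div_lt_one hp).2 hvp'
    nlinarith [Real.pi_pos]
  have hle : ‖∑ j ∈ Finset.range t, ZMod.stdAddChar (-(h * (j : ZMod p)))‖ *
      (2 * |Real.sin (Real.pi * (h.val / p))|) ≤ 2 := by
    rw [← hd, ← norm_mul, hgeom]
    refine (norm_sub_le _ _).trans ?_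
    rw [norm_pow, hone]; norm_num
  have h3 : ‖∑ j ∈ Finset.range t, ZMod.stdAddChar (-(h * (j : ZMod p)))‖ ≤
      1 / |Real.sin (Real.pi * (h.val / p))| := by
    rw [le_div_iff₀ hsin]; linarith
  refine h3.trans ((inv_sin_le_inv_add_inv (by positivity) ((div_lt_one hp).2 hvp')).trans
    (le_of_eq ?_))
  rw [Nat.cast_sub hvp.le]
  have : (p : ℝ) - h.val ≠ 0 := by linarith
  field_simp

theorem ZMod.sum_norm_sum_range_stdAddChar_le {p : ℕ} [Fact p.Prime] (t : ℕ) :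
    ∑ h ∈ Finset.univ.erase (0 : ZMod p),
      ‖∑ j ∈ Finset.range t, ZMod.stdAddChar (-(h * (j : ZMod p)))‖ ≤ p * (1 + Real.log p) := by
  have hp := (Fact.out : p.Prime)
  have hbij : ∀ f : ℕ → ℝ, ∑ h ∈ Finset.univ.erase (0 : ZMod p), f h.val =
      ∑ i ∈ Finset.Icc 1 (p - 1), f i := by
    intro f
    refine Finset.sum_bij' (fun h _ => h.val) (fun i _ => (i : ZMod p)) ?_ ?_ ?_ ?_ ?_
    · intro h hh
      have h1 := ZMod.val_lt h
      have h2 : h.val ≠ 0 := by simpa using hh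
      simp only [Finset.mem_Icc]; omega
    · intro i hi
      simp only [Finset.mem_Icc] at hi
      simp only [Finset.mem_erase, Finset.mem_univ, and_true]
      intro h0
      have := Nat.le_of_dvd (by omega) ((ZMod.natCast_eq_zero_iff i p).1 h0)
      have := hp.two_le
      omega
    · intro h _; simp
    · intro i hi
      simp only [Finset.mem_Icc] at hi
      exact ZMod.val_cast_of_lt (by have := hp.two_le; omega)
    · intro h _; rfl
  have hH : ∑ i ∈ Finset.Icc 1 (p - 1), ((i : ℝ))⁻¹ ≤ 1 + Real.log p := by
    have h1 := harmonic_le_one_add_log (p - 1)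
    rw [harmonic_eq_sum_Icc] at h1
    push_cast at h1
    refine h1.trans ?_
    have : 0 < ((p - 1 : ℕ) : ℝ) := by exact_mod_cast (by have := hp.two_le; omega)
    have := Real.log_le_log this (Nat.cast_le.2 (Nat.sub_le p 1))
    linarith
  have hrefl : ∑ i ∈ Finset.Icc 1 (p - 1), (((p - i : ℕ) : ℝ))⁻¹ =
      ∑ i ∈ Finset.Icc 1 (p - 1), ((i : ℝ))⁻¹ := by
    refine Finset.sum_bij' (fun i _ => p - i) (fun i _ => p - i) ?_ ?_ ?_ ?_ ?_ <;>
      intro i hi <;> simp only [Finset.mem_Icc] at hi ⊢ <;> omega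
  calc _ ≤ ∑ h ∈ Finset.univ.erase (0 : ZMod p),
        (p : ℝ) / 2 * ((h.val : ℝ)⁻¹ + ((p - h.val : ℕ) : ℝ)⁻¹) :=
        Finset.sum_le_sum fun h hh =>
          ZMod.norm_sum_range_stdAddChar_le t (Finset.ne_of_mem_erase hh)
    _ = p * ∑ i ∈ Finset.Icc 1 (p - 1), ((i : ℝ))⁻¹ := by
        rw [hbij fun i => (p : ℝ) / 2 * ((i : ℝ)⁻¹ + ((p - i : ℕ) : ℝ)⁻¹), ← Finset.mul_sum,
          Finset.sum_add_distrib, hrefl]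
        ring
    _ ≤ _ := by gcongr

/-- The matrix `(ψ (h (u - v) ^ 2))` is `√p` times a unitary matrix. -/
theorem ZMod.norm_sum_stdAddChar_mul_sub_sq_le {p : ℕ} [Fact p.Prime] (hp2 : p ≠ 2) {h : ZMod p}
    (hh : h ≠ 0) (x y : ZMod p → ℝ) :
    ‖∑ u, ∑ v, ((x u * y v : ℝ) : ℂ) * ZMod.stdAddChar (h * (u - v) ^ 2)‖ ≤
      √p * (√(∑ u, x u ^ 2) * √(∑ v, y v ^ 2)) := by
  have h2 : (2 : ZMod p) ≠ 0 := by
    intro h0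
    have : ((2 : ℕ) : ZMod p) = 0 := by exact_mod_cast h0
    rw [ZMod.natCast_eq_zero_iff] at this
    exact hp2 ((Nat.prime_dvd_prime_iff_eq Fact.out Nat.prime_two).1 this)
  set g : ZMod p → ℂ := fun u => ∑ v, (y v : ℂ) * ZMod.stdAddChar (h * (u - v) ^ 2)
  have hg : ∑ u, ‖g u‖ ^ 2 = p * ∑ v, y v ^ 2 := by
    have hconj : ∀ z : ZMod p, starRingEnd ℂ (ZMod.stdAddChar z : ℂ) = ZMod.stdAddChar (-z) :=
      fun z => by rw [AddChar.map_neg_eq_conj]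
    have : ((∑ u, ‖g u‖ ^ 2 : ℝ) : ℂ) = ((p * ∑ v, y v ^ 2 : ℝ) : ℂ) := by
      push_cast
      -- The terms in `u²` cancel, so `u` enters only through a linear character. Orthogonality
      -- leaves `w = v`, since `2 h ≠ 0`; here `p` must be odd.
      have e1 : ∀ u, ((‖g u‖ : ℂ)) ^ 2 = ∑ v, ∑ w, (y v * y w : ℂ) *
          ZMod.stdAddChar (h * (v ^ 2 - w ^ 2)) * ZMod.stdAddChar (u * (2 * h * (w - v))) := by
        intro u
        rw [← Complex.mul_conj', map_sum, Finset.sum_mul_sum]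
        refine Finset.sum_congr rfl fun v _ => Finset.sum_congr rfl fun w _ => ?_
        rw [map_mul (starRingEnd ℂ), hconj, Complex.conj_ofReal, mul_assoc (_ * _),
          ← AddChar.map_add_eq_mul, mul_mul_mul_comm, ← AddChar.map_add_eq_mul]
        congr 2; ring
      simp_rw [e1]
      rw [Finset.sum_comm, Finset.mul_sum]
      refine Finset.sum_congr rfl fun v _ => ?_
      rw [Finset.sum_comm]
      simp_rw [← Finset.mul_sum, AddChar.sum_mulShift _ (ZMod.isPrimitive_stdAddChar p)]
      rw [Finset.sum_eq_single v]
      · simp [ZMod.card]; ring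
      · intro w _ hw
        rw [if_neg (by simp [h2, hh, sub_eq_zero, hw])]; simp
      · simp
    exact_mod_cast this
  have e2 : ∑ u, ∑ v, ((x u * y v : ℝ) : ℂ) * ZMod.stdAddChar (h * (u - v) ^ 2) =
      ∑ u, (x u : ℂ) * g u := by
    refine Finset.sum_congr rfl fun u _ => ?_
    rw [Finset.mul_sum]
    refine Finset.sum_congr rfl fun v _ => ?_
    push_cast; ring
  rw [e2]
  calc _ ≤ ∑ u, |x u| * ‖g u‖ := by
        refine (norm_sum_le _ _).trans (Finset.sum_le_sum fun u _ => ?_)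
        rw [norm_mul, Complex.norm_real, Real.norm_eq_abs]
    _ ≤ √(∑ u, |x u| ^ 2) * √(∑ u, ‖g u‖ ^ 2) := Real.sum_mul_le_sqrt_mul_sqrt _ _ _
    _ = _ := by
        rw [hg, Real.sqrt_mul (by positivity)]
        simp only [sq_abs]; ring

theorem ZMod.indicator_val_le_eq {p : ℕ} [Fact p.Prime] {t : ℕ} (ht : t < p) (s : ZMod p) :
    ((if s.val ≤ t then 1 else 0 : ℝ) : ℂ) = (p : ℂ)⁻¹ * ∑ h : ZMod p,
      (∑ j ∈ Finset.range (t + 1), ZMod.stdAddChar (-(h * (j : ZMod p)))) * ZMod.stdAddChar (h * s) := by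
  have hp : (p : ℂ) ≠ 0 := by exact_mod_cast (Fact.out : p.Prime).ne_zero
  have : ∑ h : ZMod p, (∑ j ∈ Finset.range (t + 1), (ZMod.stdAddChar (-(h * (j : ZMod p))) : ℂ)) *
      ZMod.stdAddChar (h * s) = ∑ j ∈ Finset.range (t + 1), if s - j = 0 then (p : ℂ) else 0 := by
    simp_rw [Finset.sum_mul]
    rw [Finset.sum_comm]
    refine Finset.sum_congr rfl fun j _ => ?_
    have := AddChar.sum_mulShift (s - (j : ZMod p)) (ZMod.isPrimitive_stdAddChar p)
    rw [ZMod.card] at this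
    push_cast at this
    rw [← this]
    refine Finset.sum_congr rfl fun h _ => ?_
    rw [← AddChar.map_add_eq_mul]; congr 1; ring
  rw [this]
  by_cases hs : s.val ≤ t
  · rw [if_pos hs, Finset.sum_eq_single s.val]
    · simp [hp]
    · intro j hj hjs
      rw [if_neg]
      intro h0
      rw [sub_eq_zero] at h0
      apply hjs
      rw [h0, ZMod.val_cast_of_lt]
      rw [Finset.mem_range] at hj; omega
    · intro h; simp at h; omega
  · rw [if_neg hs, Finset.sum_eq_zero]
    · simp
    · intro j hj
      rw [if_neg]
      intro h0
      rw [sub_eq_zero] at h0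
      apply hs
      rw [Finset.mem_range] at hj
      rw [h0, ZMod.val_cast_of_lt (by omega)]; omega

/-- Subtracting `(t + 1) / p` removes exactly the zero frequency; each remaining one costs its
coefficient times `√p`. -/
theorem ZMod.abs_sum_indicator_sub_sq_le {p : ℕ} [Fact p.Prime] (hp2 : p ≠ 2) {t : ℕ} (ht : t < p)
    (x y : ZMod p → ℝ) :
    |∑ u, ∑ v, x u * y v * ((if ((u - v) ^ 2).val ≤ t then 1 else 0) - (t + 1) / p)| ≤
      √p * (1 + Real.log p) * (√(∑ u, x u ^ 2) * √(∑ v, y v ^ 2)) := by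
  have hp : 0 < (p : ℝ) := by exact_mod_cast (Fact.out : p.Prime).pos
  have hlog : 0 ≤ Real.log p := Real.log_natCast_nonneg p
  set c : ZMod p → ℂ := fun h => ∑ j ∈ Finset.range (t + 1), ZMod.stdAddChar (-(h * (j : ZMod p)))
  have hc0 : c 0 = t + 1 := by simp [c]
  have e : ((∑ u, ∑ v, x u * y v * ((if ((u - v) ^ 2).val ≤ t then 1 else 0) - (t + 1) / p) : ℝ)
      : ℂ) = (p : ℂ)⁻¹ * ∑ h ∈ Finset.univ.erase (0 : ZMod p), c h *
        ∑ u, ∑ v, ((x u * y v : ℝ) : ℂ) * ZMod.stdAddChar (h * (u - v) ^ 2) := by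
    have e1 : ∀ u v : ZMod p,
        (((if ((u - v) ^ 2).val ≤ t then 1 else 0) - (t + 1) / p : ℝ) : ℂ) =
        (p : ℂ)⁻¹ * ∑ h ∈ Finset.univ.erase (0 : ZMod p), c h *
          ZMod.stdAddChar (h * (u - v) ^ 2) := by
      intro u v
      rw [Complex.ofReal_sub, ZMod.indicator_val_le_eq ht,
        ← Finset.add_sum_erase _ _ (Finset.mem_univ (0 : ZMod p))]
      change (p : ℂ)⁻¹ * (c 0 * _ + _) - _ = _
      rw [hc0]
      simp [c]; ring
    rw [Complex.ofReal_sum]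
    simp_rw [Complex.ofReal_sum, Complex.ofReal_mul (_ * _), e1, Finset.mul_sum]
    conv_rhs => rw [Finset.sum_comm]
    refine Finset.sum_congr rfl fun u _ => ?_
    conv_rhs => rw [Finset.sum_comm]
    refine Finset.sum_congr rfl fun v _ => Finset.sum_congr rfl fun h _ => ?_
    ring
  rw [← Real.norm_eq_abs, ← Complex.norm_real, e, norm_mul]
  calc _ ≤ (p : ℝ)⁻¹ * ∑ h ∈ Finset.univ.erase (0 : ZMod p), ‖c h‖ *
        (√p * (√(∑ u, x u ^ 2) * √(∑ v, y v ^ 2))) := by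
        rw [norm_inv, Complex.norm_natCast]
        refine mul_le_mul_of_nonneg_left ((norm_sum_le _ _).trans
          (Finset.sum_le_sum fun h hh => ?_)) (by positivity)
        rw [norm_mul]
        exact mul_le_mul_of_nonneg_left (ZMod.norm_sum_stdAddChar_mul_sub_sq_le hp2
          (Finset.ne_of_mem_erase hh) x y) (norm_nonneg _)
    _ ≤ (p : ℝ)⁻¹ * ((p * (1 + Real.log p)) * (√p * (√(∑ u, x u ^ 2) * √(∑ v, y v ^ 2)))) := by
        rw [← Finset.sum_mul]
        gcongr
        exact ZMod.sum_norm_sum_range_stdAddChar_le (t + 1)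
    _ = _ := by field_simp

/-! ### Degrees and quasirandomness of the graphs `Q p t`. -/

namespace HermitianDisc

/-- The reduction map identifying `Fin p` with `ZMod p`. -/
def finEquivZMod (p : ℕ) [NeZero p] : Fin p ≃ ZMod p where
  toFun u := ((u : ℕ) : ZMod p)
  invFun x := ⟨x.val, x.val_lt⟩
  left_inv u := Fin.ext (ZMod.val_cast_of_lt u.2)
  right_inv x := ZMod.natCast_zmod_val x

theorem Q_adj_iff {p t : ℕ} [NeZero p] (u v : Fin p) :
    (Q p t).Adj u v ↔ u ≠ v ∧ ((finEquivZMod p u - finEquivZMod p v) ^ 2).val ≤ t := by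
  have hp : (0 : ℚ) < p := by exact_mod_cast Nat.pos_of_ne_zero (NeZero.ne p)
  have e : ((((u : ℕ) : ℚ) - ((v : ℕ) : ℚ)) ^ 2 / (p : ℚ)) =
      (((((u : ℕ) : ℤ) - ((v : ℕ) : ℤ)) ^ 2 : ℤ) : ℚ) / (p : ℚ) := by push_cast; rfl
  have e2 : (finEquivZMod p u - finEquivZMod p v) ^ 2 =
      (((((u : ℕ) : ℤ) - ((v : ℕ) : ℤ)) ^ 2 : ℤ) : ZMod p) := by
    push_cast; rfl
  change (u ≠ v ∧ Int.fract _ ≤ _) ↔ _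
  rw [e, Int.fract_div_intCast_eq_div_intCast_mod, div_le_div_iff_of_pos_right hp, e2,
    ← ZMod.val_intCast]
  norm_cast

/-- The common degree of the vertices of `Q p t`. -/
def degreeQ (p t : ℕ) [NeZero p] : ℕ :=
  (Finset.univ.filter fun x : ZMod p => x ≠ 0 ∧ (x ^ 2).val ≤ t).card

theorem isRegularOfDegree_Q (p t : ℕ) [NeZero p] :
    (Q p t).IsRegularOfDegree (degreeQ p t) := by
  intro u
  rw [← SimpleGraph.card_neighborFinset_eq_degree, degreeQ]
  refine Finset.card_bij' (fun v _ => finEquivZMod p u - finEquivZMod p v)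
    (fun x _ => (finEquivZMod p).symm (finEquivZMod p u - x)) ?_ ?_ ?_ ?_
  · intro v hv
    rw [SimpleGraph.mem_neighborFinset, Q_adj_iff] at hv
    simp only [Finset.mem_filter, Finset.mem_univ, true_and]
    exact ⟨by simpa [sub_eq_zero] using hv.1, hv.2⟩
  · intro x hx
    simp only [Finset.mem_filter, Finset.mem_univ, true_and] at hx
    rw [SimpleGraph.mem_neighborFinset, Q_adj_iff]
    refine ⟨fun h => hx.1 ?_, by simpa using hx.2⟩
    have h' := congrArg (finEquivZMod p) h
    rw [Equiv.apply_symm_apply] at h'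
    exact sub_eq_self.1 h'.symm
  · intro v _; simp
  · intro x _; simp

theorem mem_degreeSet_iff {p d : ℕ} [NeZero p] :
    d ∈ degreeSet p ↔ ∃ t ∈ Finset.Icc 1 p, degreeQ p t = d := by
  refine exists_congr fun t => and_congr_right fun _ => ⟨fun h => ?_, fun h => ?_⟩
  · rw [← h 0, isRegularOfDegree_Q p t 0]
  · exact h ▸ isRegularOfDegree_Q p t

theorem degreeQ_zero (p : ℕ) [Fact p.Prime] : degreeQ p 0 = 0 := by
  rw [degreeQ, Finset.card_eq_zero, Finset.filter_eq_empty_iff]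
  intro x _ h
  exact h.1 (by simpa using h.2)

theorem degreeQ_self (p : ℕ) [NeZero p] : degreeQ p p = p - 1 := by
  have : (Finset.univ.filter fun x : ZMod p => x ≠ 0 ∧ (x ^ 2).val ≤ p) =
      Finset.univ.erase 0 := by
    ext x; simp [(ZMod.val_lt (x ^ 2)).le]
  rw [degreeQ, this, Finset.card_erase_of_mem (Finset.mem_univ _), Finset.card_univ, ZMod.card]

/-- A residue has at most two square roots in a field. -/
theorem degreeQ_succ_le (p t : ℕ) [Fact p.Prime] : degreeQ p (t + 1) ≤ degreeQ p t + 2 := by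
  set S := Finset.univ.filter fun x : ZMod p => (x ^ 2).val = t + 1
  have h1 : S.card ≤ 2 := by
    rcases S.eq_empty_or_nonempty with h | ⟨x, hx⟩
    · simp [h]
    · refine (Finset.card_le_card (t := {x, -x}) fun y hy => ?_).trans Finset.card_le_two
      simp only [S, Finset.mem_filter, Finset.mem_univ, true_and] at hx hy
      have := ZMod.val_injective p (hy.trans hx.symm)
      simpa using sq_eq_sq_iff_eq_or_eq_neg.1 this
  refine (Finset.card_le_card (t := (Finset.univ.filter fun x : ZMod p =>
    x ≠ 0 ∧ (x ^ 2).val ≤ t) ∪ S) fun x hx => ?_).trans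
    ((Finset.card_union_le _ _).trans (Nat.add_le_add_left h1 _))
  simp only [S, Finset.mem_filter, Finset.mem_univ, true_and, Finset.mem_union] at hx ⊢
  rcases hx.2.lt_or_eq with h | h
  · exact Or.inl ⟨hx.1, by omega⟩
  · exact Or.inr h

/-- A discrete intermediate value argument: the degrees climb from 0 to `p - 1` in steps of at most
2. -/
theorem exists_mem_degreeSet_abs_sub_le (p : ℕ) [Fact p.Prime] {τ : ℝ} (h0 : 0 < τ) (h1 : τ ≤ p) :
    ∃ d ∈ degreeSet p, |(d : ℝ) - τ| ≤ 2 := by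
  have hp := (Fact.out : p.Prime)
  by_cases h : τ ≤ (p - 1 : ℕ)
  · have hex : ∃ t, τ ≤ degreeQ p t := ⟨p, by rwa [degreeQ_self]⟩
    classical
    set t := Nat.find hex
    have ht : τ ≤ degreeQ p t := Nat.find_spec hex
    -- `degreeSet` only admits `t ≥ 1`; this is why `τ` must be positive.
    have ht0 : t ≠ 0 := by
      intro h'
      rw [h', degreeQ_zero] at ht
      simp only [Nat.cast_zero] at ht
      linarith
    obtain ⟨s, hs⟩ := Nat.exists_eq_succ_of_ne_zero ht0
    have hlt : (degreeQ p s : ℝ) < τ := not_le.1 (Nat.find_min hex (by omega))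
    have htp : t ≤ p := Nat.find_min' hex (by rwa [degreeQ_self])
    refine ⟨degreeQ p t, mem_degreeSet_iff.2 ⟨t, Finset.mem_Icc.2 ⟨by omega, htp⟩, rfl⟩, ?_⟩
    have h2 : (degreeQ p t : ℝ) ≤ degreeQ p s + 2 := by
      rw [hs]; exact_mod_cast degreeQ_succ_le p s
    rw [abs_le]; constructor <;> linarith
  · refine ⟨p - 1, mem_degreeSet_iff.2 ⟨p, Finset.mem_Icc.2 ⟨hp.one_le, le_rfl⟩,
      degreeQ_self p⟩, ?_⟩
    rw [Nat.cast_sub hp.one_le] at h ⊢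
    push_cast at h ⊢
    rw [abs_le]; constructor <;> linarith

/-- A bound for the bilinear forms of the adjacency matrices `Q p t` after removing
the all-ones component. -/
noncomputable def errorNorm (p : ℕ) : ℝ := 2 * (1 + √p * (1 + Real.log p))

theorem errorNorm_nonneg (p : ℕ) : 0 ≤ errorNorm p := by
  have := Real.log_natCast_nonneg p
  rw [errorNorm]; positivity

/-- The Fourier bound is centred at `α`, not at `d / p`, and counts the diagonal. Removing the
diagonal costs 1; recentring costs as much again as the whole bound, hence the factor 2 in
`errorNorm`. -/
theorem abs_sum_adjMatrix_Q_sub_le {p : ℕ} [Fact p.Prime] (hp2 : p ≠ 2) (t : ℕ)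
    (x y : Fin p → ℝ) :
    |∑ u, ∑ v, x u * y v * ((Q p t).adjMatrix ℝ u v - (degreeQ p t : ℝ) / p)| ≤
      errorNorm p * (√(∑ u, x u ^ 2) * √(∑ v, y v ^ 2)) := by
  have hp := (Fact.out : p.Prime)
  have hp0 : (0 : ℝ) < p := by exact_mod_cast hp.pos
  set K := √p * (1 + Real.log p)
  -- The Fourier expansion needs a threshold below `p`; residues do not notice the truncation.
  set s := min t (p - 1)
  set α : ℝ := ((s : ℝ) + 1) / p
  have hadj : ∀ u v : Fin p, (Q p t).adjMatrix ℝ u v =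
      (if ((finEquivZMod p u - finEquivZMod p v) ^ 2).val ≤ s then 1 else 0) -
        if u = v then 1 else 0 := by
    intro u v
    have h1 := ZMod.val_lt ((finEquivZMod p u - finEquivZMod p v) ^ 2)
    have h2 : ((finEquivZMod p u - finEquivZMod p v) ^ 2).val ≤ s ↔
      ((finEquivZMod p u - finEquivZMod p v) ^ 2).val ≤ t := by omega
    rw [SimpleGraph.adjMatrix_apply]
    simp only [Q_adj_iff, h2]
    by_cases huv : u = v
    · subst huv; simp
    · simp [huv]
  have hW : ∀ x y : Fin p → ℝ,
      |∑ u, ∑ v, x u * y v * ((Q p t).adjMatrix ℝ u v - α)| ≤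
        (1 + K) * (√(∑ u, x u ^ 2) * √(∑ v, y v ^ 2)) := by
    intro x y
    have h1 := ZMod.abs_sum_indicator_sub_sq_le hp2 (t := s) (by have := hp.pos; omega)
      (x ∘ (finEquivZMod p).symm) (y ∘ (finEquivZMod p).symm)
    simp only [← (finEquivZMod p).sum_comp, Function.comp_apply, Equiv.symm_apply_apply] at h1
    have h2 : |∑ u, x u * y u| ≤ √(∑ u, x u ^ 2) * √(∑ v, y v ^ 2) := by
      rw [← Real.sqrt_mul (Finset.sum_nonneg fun _ _ => sq_nonneg _)]
      exact Real.abs_le_sqrt (Finset.sum_mul_sq_le_sq_mul_sq _ _ _)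
    have h3 : ∑ u, ∑ v, x u * y v * ((Q p t).adjMatrix ℝ u v - α) =
        ∑ u, ∑ v, x u * y v *
          ((if ((finEquivZMod p u - finEquivZMod p v) ^ 2).val ≤ s then 1 else 0) - α) -
          ∑ u, x u * y u := by
      rw [← Finset.sum_sub_distrib]
      refine Finset.sum_congr rfl fun u _ => ?_
      have : x u * y u = ∑ v, x u * y v * if u = v then 1 else 0 := by simp
      rw [this, ← Finset.sum_sub_distrib]
      refine Finset.sum_congr rfl fun v _ => ?_
      rw [hadj]; ring
    rw [h3]
    refine (abs_sub _ _).trans ?_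
    linarith
  set d := degreeQ p t
  have hsum : ∑ u : Fin p, ∑ v : Fin p, (Q p t).adjMatrix ℝ u v = p * d := by
    have : ∀ u, ∑ v : Fin p, (Q p t).adjMatrix ℝ u v = d := by
      intro u
      have := SimpleGraph.adjMatrix_mulVec_const_apply_of_regular
        (isRegularOfDegree_Q p t) (a := (1 : ℝ)) (v := u)
      simpa [Matrix.mulVec, dotProduct] using this
    simp_rw [this]
    simp
  -- Testing the bound on the all-ones vector shows that `α` is close to the true density.
  have hd : |α - d / p| * p ≤ 1 + K := by
    have h1 := hW (fun _ => 1) (fun _ => 1)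
    simp only [one_mul, Finset.sum_sub_distrib, hsum] at h1
    simp at h1
    have e : (p : ℝ) * d - p * (p * α) = -((α - d / p) * p) * p := by field_simp; ring
    rw [e, abs_mul, abs_neg, abs_mul, abs_of_pos hp0] at h1
    exact le_of_mul_le_mul_right h1 hp0
  have hs : ∀ x : Fin p → ℝ, |∑ u, x u| ≤ √p * √(∑ u, x u ^ 2) := by
    intro x
    rw [← Real.sqrt_mul hp0.le]
    refine Real.abs_le_sqrt ?_
    simpa using sq_sum_le_card_mul_sum_sq (s := (Finset.univ : Finset (Fin p))) (f := x)
  have hsplit : ∑ u, ∑ v, x u * y v * ((Q p t).adjMatrix ℝ u v - (d : ℝ) / p) =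
      ∑ u, ∑ v, x u * y v * ((Q p t).adjMatrix ℝ u v - α) +
        (α - d / p) * ((∑ u, x u) * ∑ v, y v) := by
    rw [Finset.sum_mul_sum, Finset.mul_sum, ← Finset.sum_add_distrib]
    refine Finset.sum_congr rfl fun u _ => ?_
    rw [Finset.mul_sum, ← Finset.sum_add_distrib]
    refine Finset.sum_congr rfl fun v _ => ?_
    ring
  rw [hsplit]
  refine (abs_add_le _ _).trans ?_
  have h4 : |(α - d / p) * ((∑ u, x u) * ∑ v, y v)| ≤
      (1 + K) * (√(∑ u, x u ^ 2) * √(∑ v, y v ^ 2)) := by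
    rw [abs_mul, abs_mul]
    calc _ ≤ |α - d / p| * ((√p * √(∑ u, x u ^ 2)) * (√p * √(∑ u, y u ^ 2))) := by
          gcongr
          · exact hs x
          · exact hs y
      _ = |α - d / p| * p * (√(∑ u, x u ^ 2) * √(∑ u, y u ^ 2)) := by
          linear_combination (|α - d / p| * √(∑ u, x u ^ 2) * √(∑ u, y u ^ 2)) *
            Real.mul_self_sqrt hp0.le
      _ ≤ _ := by gcongr
  have := hW x y
  rw [errorNorm]
  linarith

/-! ### The block matrix is nearly of rank one. -/

/-- Cut at the index `T = s / m`. Before it, `|a i| ≤ m` and the sum of `1/√i` is at most `2√T`;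
after it, `1/√i ≤ 1/√T` and the total `s` is used. The parts are `2 √(m s)` and `√(m s)`. -/
theorem abs_sum_div_sqrt_le {k : ℕ} {m s : ℝ} (hm : 0 < m) (hs : 0 < s) {a : Fin k → ℝ}
    (ha : ∀ i, |a i| ≤ m) (has : ∑ i, |a i| ≤ s) :
    |∑ i, a i / √((i : ℝ) + 1)| ≤ 3 * √(m * s) := by
  set T := s / m
  have hT : 0 < T := by positivity
  -- Truncation at `T` lets one telescoping sum serve both ranges.
  set g : ℕ → ℝ := fun i => √(min (i : ℝ) T)
  have hmono : ∀ i : ℕ, g i ≤ g (i + 1) := fun i =>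
    Real.sqrt_le_sqrt (min_le_min_right _ (by push_cast; linarith))
  have hterm : ∀ i : Fin k, |a i / √((i : ℝ) + 1)| ≤
      2 * m * (g (i + 1) - g i) + |a i| / √T := by
    intro i
    have hi : 0 < (i : ℝ) + 1 := by positivity
    have hsq : 0 < √((i : ℝ) + 1) := Real.sqrt_pos.2 hi
    rw [abs_div, abs_of_pos hsq]
    by_cases h : (i : ℝ) + 1 ≤ T
    · have e1 : g (i + 1) = √((i : ℝ) + 1) := by simp only [g]; push_cast; rw [min_eq_left h]
      have e2 : g i = √(i : ℝ) := by simp only [g]; rw [min_eq_left (by linarith)]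
      have h3 : 1 / √((i : ℝ) + 1) ≤ 2 * (√((i : ℝ) + 1) - √(i : ℝ)) := by
        rw [div_le_iff₀ hsq]
        nlinarith [sq_nonneg (√((i : ℝ) + 1) - √(i : ℝ)), Real.mul_self_sqrt hi.le,
          Real.mul_self_sqrt (Nat.cast_nonneg (α := ℝ) i)]
      have h4 : |a i| / √((i : ℝ) + 1) ≤ m * (1 / √((i : ℝ) + 1)) := by
        rw [mul_one_div]; exact div_le_div_of_nonneg_right (ha i) hsq.le
      have h5 := mul_le_mul_of_nonneg_left h3 hm.le
      have h6 : 0 ≤ |a i| / √T := by positivity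
      rw [e1, e2]; linarith
    · have h3 : |a i| / √((i : ℝ) + 1) ≤ |a i| / √T :=
        div_le_div_of_nonneg_left (abs_nonneg _) (Real.sqrt_pos.2 hT)
          (Real.sqrt_le_sqrt (not_le.1 h).le)
      have := mul_nonneg (by positivity : 0 ≤ 2 * m) (sub_nonneg.2 (hmono i))
      linarith
  have hg : g k - g 0 ≤ √T := by
    have : g 0 = 0 := by simp [g, hT.le]
    rw [this, sub_zero]
    exact Real.sqrt_le_sqrt (min_le_right _ _)
  calc _ ≤ ∑ i : Fin k, (2 * m * (g (i + 1) - g i) + |a i| / √T) :=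
        (Finset.abs_sum_le_sum_abs _ _).trans (Finset.sum_le_sum fun i _ => hterm i)
    _ = 2 * m * (g k - g 0) + (∑ i, |a i|) / √T := by
        rw [Finset.sum_add_distrib, ← Finset.mul_sum, ← Finset.sum_div,
          Fin.sum_univ_eq_sum_range (fun i => g (i + 1) - g i), Finset.sum_range_sub]
    _ ≤ 2 * m * √T + s / √T := by gcongr
    _ = 3 * √(m * s) := by
        have h1 : √(m * s) = m * √T := by
          rw [show m * s = m ^ 2 * T by simp only [T]; field_simp, Real.sqrt_mul (by positivity),
            Real.sqrt_sq hm.le]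
        have h2 : s / √T = m * √T := by
          rw [div_eq_iff (Real.sqrt_pos.2 hT).ne', mul_assoc, Real.mul_self_sqrt hT.le]
          simp only [T]; field_simp
        rw [h1, h2]; ring

theorem sum_sqrt_le_sqrt_card_mul {ι : Type*} [Fintype ι] {f : ι → ℝ} (hf : ∀ i, 0 ≤ f i) :
    ∑ i, √(f i) ≤ √(Fintype.card ι * ∑ i, f i) := by
  refine Real.le_sqrt_of_sq_le ?_
  refine (sq_sum_le_card_mul_sum_sq).trans (le_of_eq ?_)
  simp [Real.sq_sqrt (hf _)]

theorem target_pos_and_le (p i j : ℕ) (hp : 0 < p) :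
    0 < (p : ℝ) / 2 + (p : ℝ) / (2 * √(((i : ℝ) + 1) * ((j : ℝ) + 1))) ∧
    (p : ℝ) / 2 + (p : ℝ) / (2 * √(((i : ℝ) + 1) * ((j : ℝ) + 1))) ≤ p := by
  have hp : (0 : ℝ) < p := by exact_mod_cast hp
  have h1 : 1 ≤ √(((i : ℝ) + 1) * ((j : ℝ) + 1)) := by
    rw [Real.one_le_sqrt]
    nlinarith [Nat.cast_nonneg (α := ℝ) i, Nat.cast_nonneg (α := ℝ) j,
      mul_nonneg (Nat.cast_nonneg (α := ℝ) i) (Nat.cast_nonneg (α := ℝ) j)]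
  refine ⟨by positivity, ?_⟩
  have : (p : ℝ) / (2 * √(((i : ℝ) + 1) * ((j : ℝ) + 1))) ≤ p / 2 :=
    div_le_div_of_nonneg_left hp.le (by norm_num) (by linarith)
  linarith

/-- After subtracting `1 / 2` from its entries, the block matrix is close to the matrix whose
blocks have the constant entries `1 / (2 √(i j))`. -/
theorem abs_sum_blockMatrix_sub_le {p k : ℕ} [Fact p.Prime] (hp2 : p ≠ 2)
    {D : Matrix (Fin k) (Fin k) ℕ} {A : ℕ → Matrix (Fin p) (Fin p) ℝ}
    (hD : IsDegreeMatrix p k D) (hA : IsBlockFamily p A) (x y : Fin k × Fin p → ℝ) :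
    |∑ a, ∑ b, x a * y b * (blockMatrix D A a b - 1 / 2) -
      (∑ i : Fin k, (∑ u, x (i, u)) / √((i : ℝ) + 1)) *
        (∑ i : Fin k, (∑ u, y (i, u)) / √((i : ℝ) + 1)) / 2| ≤
      k * (2 + errorNorm p) * (√(∑ a, x a ^ 2) * √(∑ a, y a ^ 2)) := by
  have hp := (Fact.out : p.Prime)
  have hp0 : (0 : ℝ) < p := by exact_mod_cast hp.pos
  have hblock : ∀ i j : Fin k,
      |∑ u, ∑ v, x (i, u) * y (j, v) * (A (D i j) u v - 1 / 2) -
        (∑ u, x (i, u)) / √((i : ℝ) + 1) * ((∑ u, y (j, u)) / √((j : ℝ) + 1)) / 2| ≤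
        (2 + errorNorm p) * (√(∑ u, x (i, u) ^ 2) * √(∑ u, y (j, u) ^ 2)) := by
    intro i j
    obtain ⟨hmem, hmin⟩ := hD.2 i j
    obtain ⟨t, -, htd, hAt⟩ := hA _ hmem
    have hdt : degreeQ p t = D i j := by
      rw [← htd ⟨0, hp.pos⟩, isRegularOfDegree_Q p t ⟨0, hp.pos⟩]
    obtain ⟨hτ0, hτ1⟩ := target_pos_and_le p i j hp.pos
    set τ := (p : ℝ) / 2 + (p : ℝ) / (2 * √(((i : ℝ) + 1) * ((j : ℝ) + 1)))
    obtain ⟨d, hd, hdτ⟩ := exists_mem_degreeSet_abs_sub_le p hτ0 hτ1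
    have hDτ : |(D i j : ℝ) - τ| ≤ 2 := (hmin d hd).trans hdτ
    have hQ := abs_sum_adjMatrix_Q_sub_le hp2 t (fun u => x (i, u)) (fun u => y (j, u))
    rw [hdt] at hQ
    have hs : ∀ z : Fin p → ℝ, |∑ u, z u| ≤ √p * √(∑ u, z u ^ 2) := by
      intro z
      rw [← Real.sqrt_mul hp0.le]
      refine Real.abs_le_sqrt ?_
      simpa using sq_sum_le_card_mul_sum_sq (s := (Finset.univ : Finset (Fin p))) (f := z)
    -- The target degrees are chosen so that the centred density factors over `i` and `j`.
    have hτ : τ / p - 1 / 2 = 1 / √((i : ℝ) + 1) * (1 / √((j : ℝ) + 1)) / 2 := by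
      simp only [τ]
      rw [Real.sqrt_mul (by positivity)]
      field_simp; ring
    have hsplit : ∑ u, ∑ v, x (i, u) * y (j, v) * (A (D i j) u v - 1 / 2) -
        (∑ u, x (i, u)) / √((i : ℝ) + 1) * ((∑ u, y (j, u)) / √((j : ℝ) + 1)) / 2 =
        ∑ u, ∑ v, x (i, u) * y (j, v) * ((Q p t).adjMatrix ℝ u v - (D i j : ℝ) / p) +
          ((D i j : ℝ) - τ) / p * ((∑ u, x (i, u)) * ∑ v, y (j, v)) := by
      have e : ∑ u, ∑ v, x (i, u) * y (j, v) * (A (D i j) u v - 1 / 2) =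
          ∑ u, ∑ v, x (i, u) * y (j, v) * ((Q p t).adjMatrix ℝ u v - (D i j : ℝ) / p) +
          ((D i j : ℝ) / p - 1 / 2) * ((∑ u, x (i, u)) * ∑ v, y (j, v)) := by
        rw [Finset.sum_mul_sum, Finset.mul_sum, ← Finset.sum_add_distrib]
        refine Finset.sum_congr rfl fun u _ => ?_
        rw [Finset.mul_sum, ← Finset.sum_add_distrib]
        refine Finset.sum_congr rfl fun v _ => ?_
        rw [hAt]; ring
      rw [e]
      linear_combination ((∑ u, x (i, u)) * ∑ v, y (j, v)) * hτ
    rw [hsplit]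
    refine (abs_add_le _ _).trans ?_
    have h4 : |((D i j : ℝ) - τ) / p * ((∑ u, x (i, u)) * ∑ v, y (j, v))| ≤
        2 * (√(∑ u, x (i, u) ^ 2) * √(∑ u, y (j, u) ^ 2)) := by
      rw [abs_mul, abs_mul, abs_div, abs_of_pos hp0]
      calc _ ≤ 2 / p * ((√p * √(∑ u, x (i, u) ^ 2)) * (√p * √(∑ u, y (j, u) ^ 2))) := by
            gcongr
            · exact hs _
            · exact hs _
        _ = _ := by
            have := Real.mul_self_sqrt hp0.le
            field_simp
            linear_combination (√(∑ u, x (i, u) ^ 2) * √(∑ u, y (j, u) ^ 2)) * this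
    linarith
  -- Cauchy–Schwarz over the blocks, once per vector, produces the factor `k`.
  have hnorm : ∀ z : Fin k × Fin p → ℝ, ∑ i, √(∑ u, z (i, u) ^ 2) ≤ √k * √(∑ a, z a ^ 2) := by
    intro z
    have := sum_sqrt_le_sqrt_card_mul (f := fun i => ∑ u, z (i, u) ^ 2)
      fun i => Finset.sum_nonneg fun _ _ => sq_nonneg _
    rwa [Fintype.card_fin, Real.sqrt_mul (by positivity), ← Fintype.sum_prod_type'] at this
  have hsum : ∑ a, ∑ b, x a * y b * (blockMatrix D A a b - 1 / 2) -
      (∑ i : Fin k, (∑ u, x (i, u)) / √((i : ℝ) + 1)) *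
        (∑ i : Fin k, (∑ u, y (i, u)) / √((i : ℝ) + 1)) / 2 =
      ∑ i, ∑ j, (∑ u, ∑ v, x (i, u) * y (j, v) * (A (D i j) u v - 1 / 2) -
        (∑ u, x (i, u)) / √((i : ℝ) + 1) * ((∑ u, y (j, u)) / √((j : ℝ) + 1)) / 2) := by
    simp_rw [Finset.sum_sub_distrib, ← Finset.sum_div, ← Finset.sum_mul_sum]
    congr 1
    simp_rw [Fintype.sum_prod_type]
    refine Finset.sum_congr rfl fun i _ => ?_
    rw [Finset.sum_comm]
    rfl
  have hE := errorNorm_nonneg p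
  rw [hsum]
  calc _ ≤ ∑ i, ∑ j, (2 + errorNorm p) * (√(∑ u, x (i, u) ^ 2) * √(∑ u, y (j, u) ^ 2)) :=
        (Finset.abs_sum_le_sum_abs _ _).trans (Finset.sum_le_sum fun i _ =>
          (Finset.abs_sum_le_sum_abs _ _).trans (Finset.sum_le_sum fun j _ => hblock i j))
    _ = (2 + errorNorm p) * ((∑ i, √(∑ u, x (i, u) ^ 2)) * ∑ j, √(∑ u, y (j, u) ^ 2)) := by
        simp_rw [← Finset.mul_sum]; rw [Finset.sum_mul]
    _ ≤ (2 + errorNorm p) * ((√k * √(∑ a, x a ^ 2)) * (√k * √(∑ a, y a ^ 2))) := by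
        gcongr
        · exact hnorm x
        · exact hnorm y
    _ = _ := by
        linear_combination ((2 + errorNorm p) * (√(∑ a, x a ^ 2) * √(∑ a, y a ^ 2))) *
          Real.mul_self_sqrt (Nat.cast_nonneg (α := ℝ) k)

/-! ### Discrepancy of the doubled matrix. -/

/-- The matrix with the blocks `B`, `E - B`, `E - B`, `B`. -/
abbrev doubled {α : Type*} (B : Matrix α α ℝ) : Matrix (α ⊕ α) (α ⊕ α) ℝ :=
  Matrix.fromBlocks B (Matrix.of (fun _ _ => 1) - B) (Matrix.of (fun _ _ => 1) - B) B

/-- `B - 1/2` and `(E - B) - 1/2` are opposite, so only the difference of the two halves of a vector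
matters. -/
theorem sum_doubled_sub_half {α : Type*} [Fintype α] (B : Matrix α α ℝ) (f g : α ⊕ α → ℝ) :
    ∑ i, ∑ j, f i * g j * (doubled B i j - 1 / 2) =
      ∑ a, ∑ b, (f (.inl a) - f (.inr a)) * (g (.inl b) - g (.inr b)) * (B a b - 1 / 2) := by
  simp only [Fintype.sum_sum_type, Matrix.fromBlocks_apply₁₁, Matrix.fromBlocks_apply₁₂,
    Matrix.fromBlocks_apply₂₁, Matrix.fromBlocks_apply₂₂, Matrix.sub_apply, Matrix.of_apply,
    ← Finset.sum_add_distrib]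
  refine Finset.sum_congr rfl fun a _ => Finset.sum_congr rfl fun b _ => ?_
  ring

theorem avgEntry_doubled {α : Type*} [Fintype α] [Nonempty α] (B : Matrix α α ℝ) :
    avgEntry (doubled B) = 1 / 2 := by
  have h := sum_doubled_sub_half B (fun _ => 1) (fun _ => 1)
  simp only [sub_self, zero_mul, Finset.sum_const_zero, one_mul, Finset.sum_sub_distrib] at h
  simp only [Finset.sum_const, Finset.card_univ, nsmul_eq_mul] at h
  have hc : (Fintype.card (α ⊕ α) : ℝ) ≠ 0 := by exact_mod_cast Fintype.card_ne_zero
  rw [avgEntry, sub_eq_zero.1 h]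
  field_simp

/-- The difference of the halves of an indicator has entries in `{-1, 0, 1}`: block sums are at most
`p`, and the total is at most `|X|`. `abs_sum_div_sqrt_le` gives 3 for each set, and half the
product is `9/2`. -/
theorem abs_sum_doubled_blockMatrix_le {p k : ℕ} [Fact p.Prime] (hp2 : p ≠ 2)
    {D : Matrix (Fin k) (Fin k) ℕ} {A : ℕ → Matrix (Fin p) (Fin p) ℝ}
    (hD : IsDegreeMatrix p k D) (hA : IsBlockFamily p A)
    {X Y : Finset ((Fin k × Fin p) ⊕ (Fin k × Fin p))} (hX : X.Nonempty) (hY : Y.Nonempty) :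
    |∑ i ∈ X, ∑ j ∈ Y, (doubled (blockMatrix D A) i j - 1 / 2)| ≤
      (9 / 2 * p + k * (2 + errorNorm p)) * √((X.card : ℝ) * (Y.card : ℝ)) := by
  have hp := (Fact.out : p.Prime)
  have hp0 : (0 : ℝ) < p := by exact_mod_cast hp.pos
  set f : Finset ((Fin k × Fin p) ⊕ (Fin k × Fin p)) → (Fin k × Fin p) ⊕ (Fin k × Fin p) → ℝ :=
    fun X i => if i ∈ X then 1 else 0 with hf
  set x : Finset ((Fin k × Fin p) ⊕ (Fin k × Fin p)) → Fin k × Fin p → ℝ :=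
    fun X a => f X (.inl a) - f X (.inr a) with hx
  have hx1 : ∀ X a, |x X a| ≤ 1 := by
    intro X a
    simp only [hx, hf]; split_ifs <;> simp
  have hxabs : ∀ X, ∑ a, |x X a| ≤ (X.card : ℝ) := by
    intro X
    have : (X.card : ℝ) = ∑ i, f X i := by simp [hf]
    rw [this, Fintype.sum_sum_type, ← Finset.sum_add_distrib]
    refine Finset.sum_le_sum fun a _ => ?_
    simp only [hx, hf]; split_ifs <;> norm_num
  have hxsq : ∀ X, √(∑ a, x X a ^ 2) ≤ √(X.card : ℝ) := by
    intro X
    refine Real.sqrt_le_sqrt (le_trans (Finset.sum_le_sum fun a _ => ?_) (hxabs X))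
    rw [← sq_abs]
    nlinarith [hx1 X a, abs_nonneg (x X a)]
  have hmain : ∀ X : Finset ((Fin k × Fin p) ⊕ (Fin k × Fin p)), X.Nonempty →
      |∑ i : Fin k, (∑ u, x X (i, u)) / √((i : ℝ) + 1)| ≤ 3 * √(p * X.card) := by
    intro X hX
    refine abs_sum_div_sqrt_le hp0 (by exact_mod_cast hX.card_pos) (fun i => ?_) ?_
    · refine (Finset.abs_sum_le_sum_abs _ _).trans
        ((Finset.sum_le_sum fun u _ => hx1 X (i, u)).trans ?_)
      simp
    · refine le_trans (Finset.sum_le_sum fun i _ => Finset.abs_sum_le_sum_abs _ _) ?_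
      rw [← Fintype.sum_prod_type']
      exact hxabs X
  have h1 := abs_sum_blockMatrix_sub_le hp2 hD hA (x X) (x Y)
  have h2 : ∑ i ∈ X, ∑ j ∈ Y, (doubled (blockMatrix D A) i j - 1 / 2) =
      ∑ a, ∑ b, x X a * x Y b * (blockMatrix D A a b - 1 / 2) := by
    rw [← sum_doubled_sub_half]
    simp [hf, ite_mul, Finset.sum_ite_mem]
  rw [h2]
  set S := ∑ a, ∑ b, x X a * x Y b * (blockMatrix D A a b - 1 / 2)
  have hX0 : (0 : ℝ) ≤ X.card := by positivity
  have h3 : |(∑ i : Fin k, (∑ u, x X (i, u)) / √((i : ℝ) + 1)) *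
        (∑ i : Fin k, (∑ u, x Y (i, u)) / √((i : ℝ) + 1)) / 2| ≤
      9 / 2 * p * √((X.card : ℝ) * (Y.card : ℝ)) := by
    rw [abs_div, abs_mul, abs_two]
    have e : √(p * X.card) * √(p * Y.card) = p * √((X.card : ℝ) * (Y.card : ℝ)) := by
      rw [Real.sqrt_mul hp0.le, Real.sqrt_mul hp0.le, Real.sqrt_mul hX0]
      linear_combination (√(X.card : ℝ) * √(Y.card : ℝ)) * Real.mul_self_sqrt hp0.le
    have := mul_le_mul (hmain X hX) (hmain Y hY) (abs_nonneg _) (by positivity)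
    linarith
  have h4 : k * (2 + errorNorm p) * (√(∑ a, x X a ^ 2) * √(∑ a, x Y a ^ 2)) ≤
      k * (2 + errorNorm p) * √((X.card : ℝ) * (Y.card : ℝ)) := by
    rw [Real.sqrt_mul hX0]
    have := errorNorm_nonneg p
    exact mul_le_mul_of_nonneg_left (mul_le_mul (hxsq X) (hxsq Y) (Real.sqrt_nonneg _)
      (Real.sqrt_nonneg _)) (by positivity)
  have := abs_sub_abs_le_abs_sub S ((∑ i : Fin k, (∑ u, x X (i, u)) / √((i : ℝ) + 1)) *
        (∑ i : Fin k, (∑ u, x Y (i, u)) / √((i : ℝ) + 1)) / 2)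
  linarith

/-! ### Spectrum and discrepancy of regular graphs. -/

theorem le_second_eigenvalue_of_regular {V : Type*} [Fintype V] [DecidableEq V]
    (G : SimpleGraph V) [DecidableRel G.Adj] {d : ℕ} (hG : G.IsRegularOfDegree d)
    (hV : 1 < Fintype.card V) {f : V → ℝ} (hf : f ≠ 0) (hf0 : ∑ i, f i = 0) {c : ℝ}
    (hc0 : 0 ≤ c) (hcd : c ≤ d)
    (hc : c * ∑ i, f i ^ 2 ≤ ∑ i, ∑ j, f i * f j * G.adjMatrix ℝ i j) :
    c ≤ μ₂ G ∧ c ≤ σ₂ G := by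
  have : Nonempty V := Fintype.card_pos_iff.1 (by omega)
  set T := Matrix.toEuclideanLin (G.adjMatrix ℝ)
  have hT : T.IsSymmetric := Matrix.isSymmetric_toEuclideanLin_iff.2 (G.isHermitian_adjMatrix ℝ)
  have hu : (WithLp.toLp 2 (fun _ => 1) : EuclideanSpace ℝ V) ≠ 0 := by
    intro h
    have := congrFun (congrArg WithLp.ofLp h) (Classical.arbitrary V)
    simp at this
  have hv : (WithLp.toLp 2 f : EuclideanSpace ℝ V) ≠ 0 := by
    intro h
    exact hf (congrArg WithLp.ofLp h)
  set u : EuclideanSpace ℝ V := WithLp.toLp 2 fun _ => 1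
  set v : EuclideanSpace ℝ V := WithLp.toLp 2 f
  have huv : inner ℝ u v = 0 := by
    simp [u, v, PiLp.inner_apply, hf0]
  have hTu : T u = (d : ℝ) • u := by
    ext i
    have := SimpleGraph.adjMatrix_mulVec_const_apply_of_regular hG (a := (1 : ℝ)) (v := i)
    exact this
  have hvn : ‖v‖ ^ 2 = ∑ i, f i ^ 2 := by
    simp [v, EuclideanSpace.norm_sq_eq]
  have hTv : c * ‖v‖ ^ 2 ≤ inner ℝ (T v) v := by
    rw [hvn]
    refine hc.trans (le_of_eq ?_)
    rw [PiLp.inner_apply]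
    refine Finset.sum_congr rfl fun i _ => ?_
    change _ = inner ℝ ((G.adjMatrix ℝ).mulVec f i) (f i)
    simp only [Matrix.mulVec, dotProduct, RCLike.inner_apply, conj_trivial, Finset.mul_sum]
    refine Finset.sum_congr rfl fun j _ => ?_
    ring
  constructor
  · rw [μ₂, dif_pos hV]
    exact hT.le_second_eigenvalue finrank_euclideanSpace hV hu hv huv hTu hcd hTv
  · have hS := T.isSymmetric_adjoint_comp_self
    have hadj : T.adjoint = T := hT.adjoint_eq
    -- Cauchy–Schwarz turns the Rayleigh bound into a norm bound, so the same argument applies to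
    -- `T* T` with `c²` and `d²`.
    have hcT : c * ‖v‖ ≤ ‖T v‖ := by
      have h1 := hTv.trans (real_inner_le_norm _ _)
      have h2 : 0 < ‖v‖ := norm_pos_iff.2 hv
      exact le_of_mul_le_mul_right (by linarith) h2
    have h2 : c ^ 2 ≤ hS.eigenvalues finrank_euclideanSpace ⟨1, hV⟩ := by
      refine hS.le_second_eigenvalue finrank_euclideanSpace hV hu hv huv (κ := (d : ℝ) ^ 2) ?_ ?_ ?_
      · rw [LinearMap.comp_apply, hadj, hTu, map_smul, hTu, smul_smul, sq]
      · gcongr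
      · rw [LinearMap.comp_apply, LinearMap.adjoint_inner_left, real_inner_self_eq_norm_sq,
          ← mul_pow]
        gcongr
    rw [σ₂, T.singularValues_of_lt finrank_euclideanSpace hV]
    exact Real.le_sqrt_of_sq_le h2

theorem disc₂_nonneg {V : Type*} [Fintype V] [DecidableEq V] (G : SimpleGraph V)
    [DecidableRel G.Adj] : 0 ≤ disc₂ G :=
  Real.iSup_nonneg fun _ => by positivity

theorem card_interedges_eq_sum {V : Type*} [Fintype V] [DecidableEq V] (G : SimpleGraph V)
    [DecidableRel G.Adj] (X Y : Finset V) :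
    ((G.interedges X Y).card : ℝ) = ∑ i ∈ X, ∑ j ∈ Y, G.adjMatrix ℝ i j := by
  simp only [SimpleGraph.adjMatrix_apply]
  rw [← Finset.sum_product', SimpleGraph.interedges_def, Finset.card_filter]
  simp

/-- If the degree of a regular graph is half of its order, then its density differs from `1 / 2`
so little that this changes the discrepancy by at most `1`. -/
theorem disc₂_le_of_regular {V : Type*} [Fintype V] [DecidableEq V] (G : SimpleGraph V)
    [DecidableRel G.Adj] {d : ℕ} (hd : 0 < d) (hG : G.IsRegularOfDegree d)
    (hV : Fintype.card V = 2 * d) {K : ℝ} (hK : 0 ≤ K)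
    (h : ∀ X Y : Finset V, X.Nonempty → Y.Nonempty →
      |∑ i ∈ X, ∑ j ∈ Y, (G.adjMatrix ℝ i j - 1 / 2)| ≤ K * √((X.card : ℝ) * (Y.card : ℝ))) :
    disc₂ G ≤ K + 1 := by
  have hd1 : (1 : ℝ) ≤ d := by exact_mod_cast hd
  have hden : density G = d / (2 * d - 1) := by
    have h1 := G.sum_degrees_eq_twice_card_edges
    simp only [hG.degree_eq, Finset.sum_const, Finset.card_univ, hV, smul_eq_mul] at h1
    have h2 : G.edgeFinset.card = d * d := by linarith
    rw [density, h2, hV, Nat.cast_choose_two]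
    push_cast
    have : (2 * d - 1 : ℝ) ≠ 0 := by linarith
    field_simp
  refine Real.iSup_le (fun P => ?_) (by linarith)
  obtain ⟨⟨X, hX⟩, ⟨Y, hY⟩⟩ := P
  have hx : (0 : ℝ) < X.card := by exact_mod_cast hX.card_pos
  have hy : (0 : ℝ) < Y.card := by exact_mod_cast hY.card_pos
  have hxn : (X.card : ℝ) ≤ 2 * d := by exact_mod_cast hV ▸ X.card_le_univ
  have hyn : (Y.card : ℝ) ≤ 2 * d := by exact_mod_cast hV ▸ Y.card_le_univ
  set r := √((X.card : ℝ) * (Y.card : ℝ))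
  have hr : 0 < r := Real.sqrt_pos.2 (by positivity)
  have hrr : r * r = X.card * Y.card := Real.mul_self_sqrt (by positivity)
  have hrn : r ≤ 2 * d := by nlinarith
  have hsplit : ((G.interedges X Y).card : ℝ) - density G * X.card * Y.card =
      ∑ i ∈ X, ∑ j ∈ Y, (G.adjMatrix ℝ i j - 1 / 2) - (density G - 1 / 2) * (r * r) := by
    rw [card_interedges_eq_sum, hrr]
    simp only [Finset.sum_sub_distrib, Finset.sum_const, nsmul_eq_mul]
    ring
  -- The density exceeds `1/2` by `1 / (2 (2d - 1))`, and `r ≤ 2d`.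
  have h3 : |(density G - 1 / 2) * (r * r)| ≤ 1 * r := by
    have e : density G - 1 / 2 = 1 / (2 * (2 * d - 1)) := by
      rw [hden]
      have : (2 * d - 1 : ℝ) ≠ 0 := by linarith
      rw [div_sub_div _ _ this two_ne_zero, div_eq_div_iff (by positivity) (by positivity)]
      ring
    have hpos : (0 : ℝ) < 2 * (2 * d - 1) := by linarith
    rw [e, abs_of_nonneg (by positivity), ← mul_assoc]
    refine mul_le_mul_of_nonneg_right ?_ hr.le
    rw [one_div_mul_eq_div, div_le_one hpos]
    linarith
  change 1 / r * |((G.interedges X Y).card : ℝ) - density G * X.card * Y.card| ≤ K + 1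
  rw [one_div_mul_eq_div, div_le_iff₀ hr, hsplit]
  refine (abs_sub _ _).trans ?_
  linarith [h X Y hX hY]

/-! ### The constructed graphs and their second eigenvalue. -/

/-- Each row consists of a row of `B` and its complement, so it sums to `k p` whatever `D` is. -/
theorem exists_graph_of_doubled_blockMatrix {p k : ℕ} [Fact p.Prime]
    {D : Matrix (Fin k) (Fin k) ℕ} {A : ℕ → Matrix (Fin p) (Fin p) ℝ}
    (hD : IsDegreeMatrix p k D) (hA : IsBlockFamily p A) :
    ∃ (G : SimpleGraph ((Fin k × Fin p) ⊕ (Fin k × Fin p))) (_ : DecidableRel G.Adj),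
      G.adjMatrix ℝ = doubled (blockMatrix D A) ∧ G.IsRegularOfDegree (k * p) := by
  have hblock : ∀ i j, ∃ t, A (D i j) = (Q p t).adjMatrix ℝ := fun i j => by
    obtain ⟨t, -, -, h⟩ := hA _ (hD.2 i j).1
    exact ⟨t, h⟩
  have h01 : ∀ a b, blockMatrix D A a b = 0 ∨ blockMatrix D A a b = 1 := by
    intro a b
    obtain ⟨t, ht⟩ := hblock a.1 b.1
    rw [blockMatrix, Matrix.of_apply, ht, SimpleGraph.adjMatrix_apply]
    split_ifs <;> simp
  have hsymm : ∀ a b, blockMatrix D A a b = blockMatrix D A b a := by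
    intro a b
    obtain ⟨t, ht⟩ := hblock a.1 b.1
    rw [blockMatrix, Matrix.of_apply, Matrix.of_apply, hD.1.apply a.1 b.1, ht,
      SimpleGraph.adjMatrix_apply, SimpleGraph.adjMatrix_apply]
    simp only [SimpleGraph.adj_comm]
  have hdiag : ∀ a, blockMatrix D A a a = 0 := by
    intro a
    obtain ⟨t, ht⟩ := hblock a.1 a.1
    rw [blockMatrix, Matrix.of_apply, ht, SimpleGraph.adjMatrix_apply]
    simp
  have hM : (doubled (blockMatrix D A)).IsAdjMatrix := by
    refine ⟨?_, ?_, ?_⟩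
    · rintro (a | a) (b | b) <;> rcases h01 a b with h | h <;> simp [h]
    · ext i j
      rcases i with a | a <;> rcases j with b | b <;> simp [hsymm b a]
    · rintro (a | a) <;> simp [hdiag]
  classical
  refine ⟨hM.toGraph, inferInstance, hM.adjMatrix_toGraph_eq, fun i => ?_⟩
  have h1 := SimpleGraph.adjMatrix_mulVec_const_apply (G := hM.toGraph) (a := (1 : ℝ)) (v := i)
  rw [hM.adjMatrix_toGraph_eq, mul_one] at h1
  have h2 : (doubled (blockMatrix D A)).mulVec (Function.const _ 1) i = ((k * p : ℕ) : ℝ) := by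
    simp only [Matrix.mulVec, dotProduct, Fintype.sum_sum_type, Function.const_apply, mul_one,
      ← Finset.sum_add_distrib]
    rcases i with a | a <;> simp
  exact_mod_cast h1.symm.trans h2

theorem le_second_eigenvalue_of_doubled_blockMatrix {p k : ℕ} [Fact p.Prime] (hp2 : p ≠ 2)
    (hk : 0 < k) {D : Matrix (Fin k) (Fin k) ℕ} {A : ℕ → Matrix (Fin p) (Fin p) ℝ}
    (hD : IsDegreeMatrix p k D) (hA : IsBlockFamily p A)
    (G : SimpleGraph ((Fin k × Fin p) ⊕ (Fin k × Fin p))) [DecidableRel G.Adj]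
    (hGM : G.adjMatrix ℝ = doubled (blockMatrix D A)) (hG : G.IsRegularOfDegree (k * p))
    (hE : 2 * (k * (2 + errorNorm p)) ≤ p) :
    p * (Real.log k - 1) ≤ μ₂ G ∧ p * (Real.log k - 1) ≤ σ₂ G := by
  have hp := (Fact.out : p.Prime)
  have hp0 : (0 : ℝ) < p := by exact_mod_cast hp.pos
  set H : ℝ := ∑ i : Fin k, 1 / ((i : ℝ) + 1)
  set E : ℝ := k * (2 + errorNorm p)
  have hHh : H = (harmonic k : ℝ) := by
    simp only [H, harmonic]
    push_cast
    rw [Fin.sum_univ_eq_sum_range (fun i => 1 / ((i : ℝ) + 1))]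
    simp
  have hHlog : Real.log k ≤ H := by
    rw [hHh]
    refine le_trans ?_ (log_add_one_le_harmonic k)
    exact Real.log_le_log (by exact_mod_cast hk) (by push_cast; linarith)
  have hHk : H ≤ k := by
    calc H ≤ ∑ i : Fin k, (1 : ℝ) := Finset.sum_le_sum fun i _ => by
          rw [div_le_one (by positivity)]
          linarith [Nat.cast_nonneg (α := ℝ) (i : ℕ)]
      _ = k := by simp
  have hH1 : 1 ≤ H := by
    have := Finset.single_le_sum (f := fun i : Fin k => 1 / ((i : ℝ) + 1))
      (fun i _ => by positivity) (Finset.mem_univ ⟨0, hk⟩)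
    simpa [H] using this
  have hE0 : 0 ≤ E := by
    have := errorNorm_nonneg p
    positivity
  -- The direction of the rank-one part; `(w, -w)` sums to zero and has Rayleigh quotient `p H` up
  -- to `2 E`.
  set w : Fin k × Fin p → ℝ := fun a => 1 / √((a.1 : ℝ) + 1)
  set f : (Fin k × Fin p) ⊕ (Fin k × Fin p) → ℝ := Sum.elim w (-w)
  have hww : ∑ a, w a ^ 2 = p * H := by
    rw [Fintype.sum_prod_type, Finset.mul_sum]
    refine Finset.sum_congr rfl fun i _ => ?_
    simp only [w, Finset.sum_const, Finset.card_univ, Fintype.card_fin, nsmul_eq_mul, div_pow]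
    rw [Real.sq_sqrt (by positivity), one_pow]
  have hmain : ∑ i : Fin k, (∑ u, w (i, u)) / √((i : ℝ) + 1) = p * H := by
    rw [Finset.mul_sum]
    refine Finset.sum_congr rfl fun i _ => ?_
    have := Real.mul_self_sqrt (by positivity : 0 ≤ (i : ℝ) + 1)
    simp only [w, Finset.sum_const, Finset.card_univ, Fintype.card_fin, nsmul_eq_mul]
    rw [mul_div_assoc, div_div, this]
  have hb := abs_sum_blockMatrix_sub_le hp2 hD hA w w
  rw [hmain, hww, Real.mul_self_sqrt (by positivity)] at hb
  have hb' := (abs_le.1 hb).1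
  have hf0 : ∑ i, f i = 0 := by simp [f, Fintype.sum_sum_type]
  have hff : ∑ i, f i ^ 2 = 2 * (p * H) := by
    simp only [f, Fintype.sum_sum_type, Sum.elim_inl, Sum.elim_inr, Pi.neg_apply, neg_sq, hww]
    ring
  have hform : ∑ i, ∑ j, f i * f j * G.adjMatrix ℝ i j =
      4 * ∑ a, ∑ b, w a * w b * (blockMatrix D A a b - 1 / 2) := by
    have h1 := sum_doubled_sub_half (blockMatrix D A) f f
    have h2 : ∑ i, ∑ j, f i * f j * (doubled (blockMatrix D A) i j - 1 / 2) =
        ∑ i, ∑ j, f i * f j * doubled (blockMatrix D A) i j := by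
      have : ∑ i, ∑ j, f i * f j * (1 / 2 : ℝ) = 0 := by
        simp_rw [← Finset.sum_mul, ← Finset.mul_sum, hf0]; simp
      rw [← sub_zero (∑ i, ∑ j, f i * f j * doubled (blockMatrix D A) i j), ← this]
      simp_rw [← Finset.sum_sub_distrib, mul_sub]
    rw [hGM, ← h2, h1, Finset.mul_sum]
    refine Finset.sum_congr rfl fun a _ => ?_
    rw [Finset.mul_sum]
    refine Finset.sum_congr rfl fun b _ => ?_
    simp only [f, Sum.elim_inl, Sum.elim_inr, Pi.neg_apply]
    ring
  have hcard : 1 < Fintype.card ((Fin k × Fin p) ⊕ (Fin k × Fin p)) := by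
    simp only [Fintype.card_sum, Fintype.card_prod, Fintype.card_fin]
    have := Nat.mul_pos hk hp.pos
    omega
  have hfne : f ≠ 0 := by
    intro h
    have h' : ∑ i, f i ^ 2 = 0 := by simp [h]
    rw [hff] at h'
    have : 0 < 2 * (p * H) := by positivity
    linarith
  have key := le_second_eigenvalue_of_regular G hG hcard hfne hf0 (c := p * H - 2 * E)
    (by nlinarith) (by push_cast; nlinarith) (by
      rw [hff, hform]
      have e : (p * H - 2 * E) * (2 * (p * H)) = 4 * (p * H * (p * H) / 2 - E * (p * H)) := by ring
      rw [e]
      have := hb'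
      linarith)
  have hle : p * (Real.log k - 1) ≤ p * H - 2 * E := by nlinarith
  exact ⟨hle.trans key.1, hle.trans key.2⟩

/-! ### Existence, growth rates and conclusion. -/

theorem exists_isBlockFamily_isDegreeMatrix (p k : ℕ) [Fact p.Prime] :
    ∃ (D : Matrix (Fin k) (Fin k) ℕ) (A : ℕ → Matrix (Fin p) (Fin p) ℝ),
      IsDegreeMatrix p k D ∧ IsBlockFamily p A := by
  have hA : ∀ d, ∃ B : Matrix (Fin p) (Fin p) ℝ, d ∈ degreeSet p → ∃ t ∈ Finset.Icc 1 p,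
      (Q p t).IsRegularOfDegree d ∧ B = (Q p t).adjMatrix ℝ := by
    intro d
    by_cases h : d ∈ degreeSet p
    · obtain ⟨t, ht, htd⟩ := h
      exact ⟨_, fun _ => ⟨t, ht, htd, rfl⟩⟩
    · exact ⟨0, fun h' => absurd h' h⟩
  choose A hA using hA
  have hmin : ∀ τ : ℝ, ∃ d ∈ degreeSet p, ∀ x ∈ degreeSet p, |(d : ℝ) - τ| ≤ |(x : ℝ) - τ| := by
    intro τ
    obtain ⟨t, ht, h⟩ := (Finset.Icc 1 p).exists_min_image
      (fun t => |(degreeQ p t : ℝ) - τ|) ⟨1, Finset.mem_Icc.2 ⟨le_rfl, (Fact.out : p.Prime).one_le⟩⟩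
    refine ⟨degreeQ p t, mem_degreeSet_iff.2 ⟨t, ht, rfl⟩, fun x hx => ?_⟩
    obtain ⟨s, hs, rfl⟩ := mem_degreeSet_iff.1 hx
    exact h s hs
  -- Choosing the degree as a function of the real target makes `D` symmetric even when nearest
  -- degrees tie.
  choose δ hδ hδmin using hmin
  refine ⟨Matrix.of fun i j =>
    δ ((p : ℝ) / 2 + (p : ℝ) / (2 * √(((i : ℝ) + 1) * ((j : ℝ) + 1)))), A, ⟨?_, ?_⟩, hA⟩
  · ext i j
    simp [mul_comm]
  · exact fun i j => ⟨hδ _, hδmin _⟩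

theorem disc_doubled_blockMatrix_le {p k : ℕ} [Fact p.Prime] (hp2 : p ≠ 2) (hk : 0 < k)
    {D : Matrix (Fin k) (Fin k) ℕ} {A : ℕ → Matrix (Fin p) (Fin p) ℝ}
    (hD : IsDegreeMatrix p k D) (hA : IsBlockFamily p A) :
    disc (doubled (blockMatrix D A)) ≤ 9 / 2 * p + k * (2 + errorNorm p) := by
  have := errorNorm_nonneg p
  have : Nonempty (Fin k × Fin p) := ⟨⟨0, hk⟩, ⟨0, (Fact.out : p.Prime).pos⟩⟩
  refine Real.iSup_le (fun P => ?_) (by positivity)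
  obtain ⟨⟨X, hX⟩, ⟨Y, hY⟩⟩ := P
  have hx : (0 : ℝ) < X.card := by exact_mod_cast hX.card_pos
  have hy : (0 : ℝ) < Y.card := by exact_mod_cast hY.card_pos
  have hr : 0 < √((X.card : ℝ) * (Y.card : ℝ)) := Real.sqrt_pos.2 (by positivity)
  rw [avgEntry_doubled, one_div_mul_eq_div, div_le_iff₀ hr]
  exact abs_sum_doubled_blockMatrix_le hp2 hD hA hX hY

/-- With `y = p ^ (1/10)` the left side is at most `32 y ^ 8`, against `p = y ^ 10`. -/
theorem eventually_blockCount_mul_errorNorm_le :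
    ∀ᶠ p : ℕ in Filter.atTop, 2 * (blockCount p * (2 + errorNorm p)) ≤ (p : ℝ) := by
  have h1 : ∀ᶠ p : ℕ in Filter.atTop, Real.log p ≤ (p : ℝ) ^ (1 / 10 : ℝ) := by
    have := (isLittleO_log_rpow_atTop (r := 1 / 10) (by norm_num)).bound one_pos
    filter_upwards [tendsto_natCast_atTop_atTop.eventually this] with p hp
    rw [one_mul, Real.norm_eq_abs, Real.norm_eq_abs,
      abs_of_nonneg (Real.rpow_nonneg (Nat.cast_nonneg p) _)] at hp
    exact (le_abs_self _).trans hp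
  have h2 : ∀ᶠ p : ℕ in Filter.atTop, 6 ≤ (p : ℝ) ^ (1 / 10 : ℝ) :=
    tendsto_natCast_atTop_atTop.eventually
      ((tendsto_rpow_atTop (by norm_num)).eventually_ge_atTop 6)
  filter_upwards [h1, h2] with p h1 h2
  have hp : (0 : ℝ) ≤ p := Nat.cast_nonneg p
  set y := (p : ℝ) ^ (1 / 10 : ℝ) with hy
  have hp10 : (p : ℝ) = y ^ 10 := by
    rw [hy, ← Real.rpow_natCast, ← Real.rpow_mul hp]; norm_num
  have hsqrt : √(p : ℝ) = y ^ 5 := by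
    rw [hp10, show y ^ 10 = (y ^ 5) ^ 2 by ring, Real.sqrt_sq (by positivity)]
  have hk : (blockCount p : ℝ) ≤ 2 * y ^ 2 := by
    have e : (p : ℝ) ^ (1 / 5 : ℝ) = y ^ 2 := by
      rw [hy, ← Real.rpow_natCast, ← Real.rpow_mul hp]; norm_num
    have := (Nat.ceil_lt_add_one (Real.rpow_nonneg hp (1 / 5))).le
    rw [e] at this
    rw [blockCount, e]
    nlinarith
  have hE : 2 + errorNorm p ≤ 8 * y ^ 6 := by
    rw [errorNorm, hsqrt]
    have h3 : y ^ 5 * (1 + Real.log p) ≤ y ^ 5 * (2 * y) := by gcongr; linarith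
    have h4 : (1 : ℝ) ≤ y ^ 6 := one_le_pow₀ (by linarith)
    nlinarith
  calc 2 * (blockCount p * (2 + errorNorm p)) ≤ 2 * ((2 * y ^ 2) * (8 * y ^ 6)) := by
        have := errorNorm_nonneg p
        gcongr
    _ = 32 * y ^ 8 := by ring
    _ ≤ y ^ 2 * y ^ 8 := by gcongr; nlinarith
    _ = p := by rw [hp10]; ring

theorem log_le_log_blockCount {p : ℕ} (hp : 0 < p) :
    Real.log p / 5 ≤ Real.log (blockCount p) := by
  have hp : (0 : ℝ) < p := by exact_mod_cast hp
  have := Real.log_le_log (Real.rpow_pos_of_pos hp _) (Nat.le_ceil ((p : ℝ) ^ (1 / 5 : ℝ)))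
  rw [Real.log_rpow hp] at this
  rw [blockCount]
  linarith

theorem blockCount_pos {p : ℕ} (hp : 0 < p) : 0 < blockCount p :=
  Nat.ceil_pos.2 (Real.rpow_pos_of_pos (by exact_mod_cast hp) _)

/-- For large primes `p` the constructed matrices are adjacency matrices of regular graphs whose
discrepancy is `O(p)`, and whose second eigenvalue and second singular value are of order at least
`p log p`. -/
theorem exists_graph_of_isConstructed {p : ℕ} [Fact p.Prime] (hp2 : p ≠ 2)
    (hE : 2 * (blockCount p * (2 + errorNorm p)) ≤ (p : ℝ)) (hlog : 10 ≤ Real.log p)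
    {M : Matrix (Idx p) (Idx p) ℝ} (hM : IsConstructed p M) :
    ∃ (G : SimpleGraph (Idx p)) (_ : DecidableRel G.Adj), G.adjMatrix ℝ = M ∧
      Fintype.card (Idx p) = 2 * (blockCount p * p) ∧
      G.IsRegularOfDegree (blockCount p * p) ∧ disc₂ G ≤ 6 * p ∧
      p * (Real.log p / 10) ≤ μ₂ G ∧ p * (Real.log p / 10) ≤ σ₂ G := by
  have hp := (Fact.out : p.Prime)
  have hp2' : (2 : ℝ) ≤ p := by exact_mod_cast hp.two_le
  have hk := blockCount_pos hp.pos
  obtain ⟨D, A, hD, hA, rfl⟩ := hM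
  obtain ⟨G, hdec, hGM, hG⟩ := exists_graph_of_doubled_blockMatrix hD hA
  have hcard : Fintype.card (Idx p) = 2 * (blockCount p * p) := by simp [two_mul]
  have hE0 := errorNorm_nonneg p
  have hdisc := disc₂_le_of_regular G (Nat.mul_pos hk hp.pos) hG hcard
    (K := 9 / 2 * p + blockCount p * (2 + errorNorm p)) (by positivity) (fun X Y hX hY => by
      rw [hGM]; exact abs_sum_doubled_blockMatrix_le hp2 hD hA hX hY)
  obtain ⟨hμ, hσ⟩ := le_second_eigenvalue_of_doubled_blockMatrix hp2 hk hD hA G hGM hG hE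
  -- Since `log k ≥ log p / 5`, the loss of 1 is absorbed once `log p ≥ 10`.
  have hle : p * (Real.log p / 10) ≤ p * (Real.log (blockCount p) - 1) := by
    have := log_le_log_blockCount hp.pos
    gcongr
    linarith
  exact ⟨G, hdec, hGM, hcard, hG, by linarith, hle.trans hμ, hle.trans hσ⟩

theorem exists_isConstructed (p : ℕ) [Fact p.Prime] :
    ∃ M : Matrix (Idx p) (Idx p) ℝ, IsConstructed p M := by
  obtain ⟨D, A, hD, hA⟩ := exists_isBlockFamily_isDegreeMatrix p (blockCount p)
  exact ⟨_, D, A, hD, hA, rfl⟩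

theorem log_card_Idx_le {p : ℕ} (hp : 0 < p)
    (hE : 2 * (blockCount p * (2 + errorNorm p)) ≤ (p : ℝ)) :
    Real.log (Fintype.card (Idx p)) ≤ 2 * Real.log p := by
  have hp0 : (0 : ℝ) < p := by exact_mod_cast hp
  have hk : (0 : ℝ) < blockCount p := by exact_mod_cast blockCount_pos hp
  have hcard : (Fintype.card (Idx p) : ℝ) = 2 * (blockCount p * p) := by
    simp [two_mul]
  have hle : (2 * blockCount p : ℝ) ≤ p := by nlinarith [errorNorm_nonneg p]
  rw [hcard, show 2 * Real.log p = Real.log ((p : ℝ) ^ 2) by rw [Real.log_pow]; norm_num]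
  exact Real.log_le_log (by positivity) (by nlinarith)

end HermitianDisc

theorem theorem4 :
    (∃ p₀ : ℕ, ∀ p : ℕ, p.Prime → p₀ ≤ p →
      ∀ M : Matrix (HermitianDisc.Idx p) (HermitianDisc.Idx p) ℝ,
        HermitianDisc.IsConstructed p M → HermitianDisc.disc M ≤ 12 * (p : ℝ)) ∧
    (∃ C : ℝ, 0 < C ∧ ∃ p₀ : ℕ, ∀ p : ℕ, p.Prime → p₀ ≤ p →
      (∃ M : Matrix (HermitianDisc.Idx p) (HermitianDisc.Idx p) ℝ,
        HermitianDisc.IsConstructed p M) ∧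
      ∀ M : Matrix (HermitianDisc.Idx p) (HermitianDisc.Idx p) ℝ,
        HermitianDisc.IsConstructed p M →
        ∃ (G : SimpleGraph (HermitianDisc.Idx p)) (_ : DecidableRel G.Adj),
          G.adjMatrix ℝ = M ∧
          Fintype.card (HermitianDisc.Idx p) = 2 * (HermitianDisc.blockCount p * p) ∧
          G.IsRegularOfDegree (HermitianDisc.blockCount p * p) ∧
          C * HermitianDisc.disc₂ G * Real.log (Fintype.card (HermitianDisc.Idx p) : ℝ)
            ≤ HermitianDisc.μ₂ G) ∧
    ¬ ∃ C : ℝ, ∀ (V : Type) [Fintype V] [DecidableEq V] (G : SimpleGraph V)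
      [DecidableRel G.Adj] (d : ℕ), G.IsRegularOfDegree d → G ≠ ⊥ →
        HermitianDisc.σ₂ G < C * HermitianDisc.disc₂ G := by
  open HermitianDisc in
  have hlog : Filter.Tendsto (fun p : ℕ => Real.log p) Filter.atTop Filter.atTop :=
    Real.tendsto_log_atTop.comp tendsto_natCast_atTop_atTop
  obtain ⟨p₁, hp₁⟩ := Filter.eventually_atTop.1 (eventually_blockCount_mul_errorNorm_le.and
    ((hlog.eventually_ge_atTop 10).and (Filter.eventually_gt_atTop 2)))
  -- `120 = 6 * 2 * 10`, from `disc₂ G ≤ 6 p`, `log |G| ≤ 2 log p` and `μ₂ G ≥ p log p / 10`.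
  refine ⟨⟨p₁, fun p hp hle M hM => ?_⟩, ⟨1 / 120, by norm_num, p₁, fun p hp hle => ?_⟩, ?_⟩
  · obtain ⟨hE, -, hp2⟩ := hp₁ p hle
    have : Fact p.Prime := ⟨hp⟩
    obtain ⟨D, A, hD, hA, rfl⟩ := hM
    have := disc_doubled_blockMatrix_le hp2.ne' (blockCount_pos hp.pos) hD hA
    linarith [Nat.cast_nonneg (α := ℝ) p]
  · obtain ⟨hE, hlog, hp2⟩ := hp₁ p hle
    have : Fact p.Prime := ⟨hp⟩
    refine ⟨exists_isConstructed p, fun M hM => ?_⟩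
    obtain ⟨G, hdec, hGM, hcard, hG, hdisc, hμ, -⟩ :=
      exists_graph_of_isConstructed hp2.ne' hE hlog hM
    refine ⟨G, hdec, hGM, hcard, hG, le_trans ?_ hμ⟩
    have h1 := log_card_Idx_le hp.pos hE
    have h2 := mul_le_mul hdisc h1 (Real.log_natCast_nonneg _) (by positivity)
    linarith
  · rintro ⟨C, hC⟩
    -- Beyond this threshold `p log p / 10` is at least `6 |C| p`, which bounds `C * disc₂ G`.
    obtain ⟨p₂, hp₂⟩ := Filter.eventually_atTop.1 (hlog.eventually_ge_atTop (60 * |C|))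
    obtain ⟨p, hle, hp⟩ := Nat.exists_infinite_primes (max p₁ p₂)
    obtain ⟨hE, hlog, hp2⟩ := hp₁ p (le_of_max_le_left hle)
    have : Fact p.Prime := ⟨hp⟩
    obtain ⟨M, hM⟩ := exists_isConstructed p
    obtain ⟨G, hdec, hGM, hcard, hG, hdisc, -, hσ⟩ :=
      exists_graph_of_isConstructed hp2.ne' hE hlog hM
    have hpos := Nat.mul_pos (blockCount_pos hp.pos) hp.pos
    have hne : G ≠ ⊥ := by
      intro h0
      obtain ⟨w, hw⟩ := (G.degree_pos_iff_exists_adj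
        (.inl (⟨0, blockCount_pos hp.pos⟩, ⟨0, hp.pos⟩))).1 (by rw [hG.degree_eq]; exact hpos)
      rw [h0] at hw
      exact hw
    have hlt := hC (Idx p) G _ hG hne
    have h1 : C * disc₂ G ≤ |C| * (6 * p) :=
      mul_le_mul (le_abs_self C) hdisc (disc₂_nonneg G) (abs_nonneg C)
    have h2 : p * (60 * |C| / 10) ≤ p * (Real.log p / 10) := by
      have := hp₂ p (le_of_max_le_right hle)
      gcongr
    linarith
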